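/- A symmetric space on $[0,1]$ is a nonzero Banach space $X$ of (classes of) Lebesgue measurable functions on $[0,1]$ such that (1) if $|f|\le|g|$ a.e. with $f$ measurable and $g\in X$, then $f\in X$ and $\|f\|_X\le\|g\|_X$; (2) if $f\in X$ and the measurable functions $|f|,|g|$ are equimeasurable, then $g\in X$ and $\|g\|_X=\|f\|_X$. Its fundamental function is $\varphi(|A|)=\|\chi_A\|_X$ for measurable $A\subset[0,1]$; we write $X=X(\varphi)$. Put $$\alpha_\varphi=\liminf_{t\to0+}\frac{\varphi(2t)}{\varphi(t)},\qquad \beta_\varphi=\limsup_{t\to0+}\frac{\varphi(2t)}{\varphi(t)},$$ $\tilde\varphi(0)=0$ and $\tilde\varphi(t)=t/\varphi(t)$ for $t>0$, where $\varphi$ is continued by $\varphi(t)=\varphi(1)$ for $t>1$. For symmetric spaces $X(\varphi_1),\dots,X(\varphi_m)$ on $[0,1]$ and a function $f$ on $\mathbb{R}^m$ that is $2\pi$-periodic in each variable, let $f^{*_1,\dots,*_m}(t_1,\dots,t_m)$ be obtained from $|f(2\pi\bar x)|$, $\bar x\in[0,1]^m$, by taking the non-increasing rearrangement successively in $x_1,\dots,x_m$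 with the other variables fixed, and let $$\|f\|^*_{X(\bar\varphi)}=\bigl\|\dots\|f^{*_1,\dots,*_m}\|_{X(\varphi_1)}\dots\bigr\|_{X(\varphi_m)},$$ the norms being taken successively in $t_1,\dots,t_m$; $X(\bar\varphi)$ consists of the $f$ for which this is finite. Lemma. Let $1<\alpha_{\varphi_j}\le\beta_{\varphi_j}\le2$, $j=1,\dots,m$. There is a constant $C>0$, depending only on $m$ and $\varphi_1,\dots,\varphi_m$, such that for all Lebesgue measurable sets $E_j\subset[0,2\pi)$ with Lebesgue measure $|E_j|$, every $e\subset\{1,\dots,m\}$ with complement $\bar e$, all integers $n_j\ge0$ with $n_j\ge1$ for $j\in e$, and every trigonometric polynomial $$T_{\bar n}(\bar x)=\sum_{k_1=-n_1}^{n_1}\dots\sum_{k_m=-n_m}^{n_m}b_{\bar k}e^{i\langle\bar x,\bar k\rangle},\qquad b_{\bar k}\in\mathbb{C},$$ one has $T_{\bar n}\in X(\bar\varphi)$ and $$\int_{E_m}\dots\int_{E_1}|T_{\bar n}(\bar x)|\,dx_1\dots dx_m\le C\prod_{j\in e}\frac{1}{\varphi_j(n_j^{-1})}\prod_{j\in e}|E_j|\prod_{j\in\bar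 e}\tilde\varphi_j(|E_j|)\;\|T_{\bar n}\|^*_{X(\bar\varphi)}.$$ -/

import Mathlib

open MeasureTheory Set Filter Topology
open scoped ENNReal

noncomputable section

/-- Lebesgue measure on the unit interval `[0, 1]`. -/
def unitMeasure : Measure ℝ := volume.restrict (Icc (0 : ℝ) 1)

/-- `|f|` and `|g|` are equimeasurable on `[0, 1]`. -/
def AbsEquimeasurable (f g : ℝ → ℝ) : Prop :=
  ∀ l : ℝ, 0 < l → unitMeasure {x | l < |f x|} = unitMeasure {x | l < |g x|}

/-- A (nonzero) symmetric space on `[0, 1]`: a Banach space of Lebesgue measurable functions on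
`[0, 1]` (functions that agree almost everywhere on `[0, 1]` being identified), whose norm is
monotone and invariant under equimeasurability. The value of `norm` is only meaningful on
`space`, and only the values of the functions on `[0, 1]` matter. -/
structure SymmetricSpace where
  space : Submodule ℝ (ℝ → ℝ)
  norm : (ℝ → ℝ) → ℝ
  aemeasurable_of_mem : ∀ f ∈ space, AEMeasurable f unitMeasure
  norm_nonneg : ∀ f ∈ space, 0 ≤ norm f
  norm_eq_zero_iff : ∀ f ∈ space, norm f = 0 ↔ f =ᵐ[unitMeasure] 0
  norm_smul : ∀ (c : ℝ), ∀ f ∈ space, norm (c • f) = |c| * norm f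
  norm_add_le : ∀ f ∈ space, ∀ g ∈ space, norm (f + g) ≤ norm f + norm g
  complete : ∀ u : ℕ → ℝ → ℝ, (∀ k, u k ∈ space) →
    (∀ ε : ℝ, 0 < ε → ∃ N, ∀ k ≥ N, ∀ l ≥ N, norm (u k - u l) < ε) →
    ∃ f ∈ space, Tendsto (fun k => norm (u k - f)) atTop (𝓝 0)
  ideal : ∀ f g : ℝ → ℝ, AEMeasurable f unitMeasure → g ∈ space →
    (∀ᵐ x ∂unitMeasure, |f x| ≤ |g x|) → f ∈ space ∧ norm f ≤ norm g
  symmetric : ∀ f g : ℝ → ℝ, f ∈ space → AEMeasurable g unitMeasure →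
    AbsEquimeasurable f g → g ∈ space ∧ norm f = norm g
  nontrivial : ∃ f ∈ space, ¬ f =ᵐ[unitMeasure] 0

/-- `φ` (on `[0, 1]`) is the fundamental function of `X`: `φ(μ A) = ‖χ_A‖_X`. -/
def SymmetricSpace.HasFundamentalFunction (X : SymmetricSpace) (φ : ℝ → ℝ) : Prop :=
  ∀ A : Set ℝ, A ⊆ Icc 0 1 → NullMeasurableSet A volume →
    φ (volume.real A) = X.norm (A.indicator fun _ => 1)

open Classical in
/-- The norm of `X`, extended to all `[0, ∞]`-valued functions: it is `∞` outside of `X`. -/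
def SymmetricSpace.extNorm (X : SymmetricSpace) (g : ℝ → ℝ≥0∞) : ℝ≥0∞ :=
  if (∀ᵐ t ∂unitMeasure, g t ≠ ∞) ∧ (fun t => (g t).toReal) ∈ X.space then
    ENNReal.ofReal (X.norm fun t => (g t).toReal)
  else ∞

/-- `α_φ`, the lower limit of `φ(2t)/φ(t)` as `t → 0+`. -/
def lowerDilation (φ : ℝ → ℝ) : EReal :=
  liminf (fun t : ℝ => ((φ (2 * t) / φ t : ℝ) : EReal)) (𝓝[>] 0)

/-- `β_φ`, the upper limit of `φ(2t)/φ(t)` as `t → 0+`. -/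
def upperDilation (φ : ℝ → ℝ) : EReal :=
  limsup (fun t : ℝ => ((φ (2 * t) / φ t : ℝ) : EReal)) (𝓝[>] 0)

/-- `φ̃(t) = t / φ(t)` for `0 < t ≤ 1` and `φ̃(0) = 0`; for `t > 1` the function `φ`
is continued by its value `φ(1)`. -/
def assocFun (φ : ℝ → ℝ) (t : ℝ) : ℝ :=
  if t ≤ 0 then 0 else t / φ (min t 1)

/-- The non-increasing rearrangement on `[0, 1]` of a `[0, ∞]`-valued function on `[0, 1]`. -/
def rearrangement (g : ℝ → ℝ≥0∞) (t : ℝ) : ℝ≥0∞ :=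
  sInf {l : ℝ≥0∞ | 0 < l ∧ unitMeasure {x | l < g x} < ENNReal.ofReal t}

variable {m : ℕ}

/-- Rearrangement in the variable `j`, the other variables being fixed. -/
def rearrangeAt (j : Fin m) (F : (Fin m → ℝ) → ℝ≥0∞) : (Fin m → ℝ) → ℝ≥0∞ :=
  fun t => rearrangement (fun s => F (Function.update t j s)) (t j)

/-- `f^{*₁,…,*ₘ}`: the function `x ↦ |f(2πx)|` on `[0, 1]ᵐ`, rearranged successively in the
first, second, …, last variable. -/
def iteratedRearrangement (f : (Fin m → ℝ) → ℂ) : (Fin m → ℝ) → ℝ≥0∞ :=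
  (List.finRange m).foldl (fun F j => rearrangeAt j F) fun x => ‖f ((2 * Real.pi) • x)‖ₑ

/-- The norm of `X` taken in the variable `j`, the other variables being fixed; the resulting
function does not depend on its `j`-th variable. -/
def normAt (X : SymmetricSpace) (j : Fin m) (F : (Fin m → ℝ) → ℝ≥0∞) :
    (Fin m → ℝ) → ℝ≥0∞ :=
  fun t => X.extNorm fun s => F (Function.update t j s)

/-- The anisotropic norm `‖…‖f^{*₁,…,*ₘ}‖_{X₁}…‖_{Xₘ}`: the norms are taken successively in the
first (innermost), second, …, last (outermost) variable. It is finite exactly when `f` belongs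
to the anisotropic space. After all norms are taken the function is constant. -/
def anisotropicNorm (X : Fin m → SymmetricSpace) (f : (Fin m → ℝ) → ℂ) : ℝ≥0∞ :=
  (List.finRange m).foldl (fun F j => normAt (X j) j F) (iteratedRearrangement f) 0

/-- The trigonometric polynomial `∑_{|k_j| ≤ n_j} b_k e^{i⟨x,k⟩}`. -/
def trigPoly (n : Fin m → ℕ) (b : (Fin m → ℤ) → ℂ) (x : Fin m → ℝ) : ℂ :=
  ∑ k ∈ Fintype.piFinset fun j => Finset.Icc (-(n j : ℤ)) (n j : ℤ),
    b k * Complex.exp (Complex.I * ((∑ j, x j * (k j : ℝ) : ℝ) : ℂ))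

end

/-! After the change of variables `x = 2πy` everything happens on `[0,1]^m`, with sets `A j` of
measure `|E_j|/2π`. Two one-variable facts are iterated over the coordinates.

(1) For `g` non-increasing and `0 < s ≤ 1`, `∫_0^s g ≤ (s/φ(s)) ‖g‖_X`: averaging a step function
over the permutations of its equal cells flattens it on `(0,s]` without increasing its norm
(`lintegral_Ioc_le_extNorm`). Combined with the Hardy–Littlewood inequality applied slice by slice,
this bounds the integral of any measurable function over `∏ A j` by `∏ |A j|/φ_j(|A j|)` times its
anisotropic norm (`setLIntegral_pi_le_foldl_normAt`). It already yields the factors for `j ∉ e`.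

(2) For `j ∈ e`, let `G(v)` be the `L¹` norm of the slice `x_j = v`. By duality and Bernstein's
inequality `G` is at least a quarter of its supremum on an interval `I` of length `1/(128 n_j)`.
Hence `A j` may be replaced by `I` at the cost of a factor `512 n_j |A j|`
(`exists_interval_setLIntegral_scaledPoly_le`), and (1) on `I` turns this into `4|A j|/φ_j(1/(128
n_j))`.

The arguments of `φ_j` are adjusted with `φ(2t) ≤ 2φ(t)`, a consequence of symmetry and the triangle
inequality. The resulting constant is `(2π · 512)^m`. -/

noncomputable section

variable {m : ℕ}

/-! ### The unit interval and its partitions -/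

theorem unitMeasure_apply_of_subset {s : Set ℝ} (h : s ⊆ Icc 0 1) :
    unitMeasure s = volume s := Measure.restrict_eq_self _ h

instance : IsProbabilityMeasure unitMeasure :=
  ⟨by rw [unitMeasure, Measure.restrict_apply_univ]; simp⟩

/-- `rearrangement g t` is `∞` for `t ≤ 0` (infimum of the empty set), so pointwise bounds are
available only off the null set `{0}`. -/
theorem ae_unitMeasure_pos : ∀ᵐ t ∂unitMeasure, 0 < t := by
  have : ∀ᵐ x ∂unitMeasure, x ≠ 0 := by
    refine ae_restrict_of_ae ?_
    simp [ae_iff, measure_singleton]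
  filter_upwards [this, ae_restrict_mem measurableSet_Icc] with x hx0 hx
  exact lt_of_le_of_ne hx.1 hx0.symm

theorem absEquimeasurable_indicator {A B : Set ℝ} (h : unitMeasure A = unitMeasure B) :
    AbsEquimeasurable (A.indicator fun _ => 1) (B.indicator fun _ => 1) := by
  have key : ∀ (A : Set ℝ) (l : ℝ), 0 < l →
      {x | l < |A.indicator (fun _ => (1 : ℝ)) x|} = if l < 1 then A else ∅ := by
    intro A l hl
    ext x
    by_cases hx : x ∈ A <;> by_cases h1 : l < 1 <;> simp [hx, h1, hl.le, not_lt]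
  intro l hl
  rw [key A l hl, key B l hl]
  split_ifs <;> simp [h]

theorem exists_mem_Ioc_mul_iff {N : ℕ} {d : ℝ} (hd : 0 < d) {x : ℝ} :
    (∃ i : Fin (N + 1), x ∈ Ioc ((i : ℕ) * d) (((i : ℕ) + 1) * d)) ↔
      x ∈ Ioc 0 ((N + 1 : ℝ) * d) := by
  constructor
  · rintro ⟨i, h1, h2⟩
    have : ((i : ℕ) : ℝ) ≤ N := by exact_mod_cast Nat.lt_succ_iff.1 i.2
    exact ⟨lt_of_le_of_lt (by positivity) h1, h2.trans (by gcongr)⟩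
  · rintro ⟨h1, h2⟩
    have hpos : 0 < ⌈x / d⌉₊ := Nat.ceil_pos.2 (by positivity)
    obtain ⟨k, hk⟩ : ∃ k, ⌈x / d⌉₊ = k + 1 := ⟨_, (Nat.succ_pred_eq_of_pos hpos).symm⟩
    have hle : ⌈x / d⌉₊ ≤ N + 1 := by
      apply Nat.ceil_le.2
      rw [div_le_iff₀ hd]; exact_mod_cast h2
    refine ⟨⟨k, by omega⟩, ?_, ?_⟩
    · have := Nat.ceil_lt_add_one (a := x / d) (by positivity)
      rw [hk] at this
      push_cast at this
      rw [← lt_div_iff₀ hd]; simpa using this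
    · have := Nat.le_ceil (x / d)
      rw [hk, div_le_iff₀ hd] at this
      exact_mod_cast this

theorem pairwise_disjoint_Ioc_nat_mul {N : ℕ} {d : ℝ} (hd : 0 < d) :
    Pairwise (Function.onFun Disjoint
      fun i : Fin N => Ioc (((i : ℕ) : ℝ) * d) (((i : ℕ) + 1) * d)) := by
  refine pairwise_disjoint_on _ |>.2 fun i j hij => ?_
  rw [Set.disjoint_left]
  rintro x ⟨-, h2⟩ ⟨h3, -⟩
  have : ((i : ℕ) : ℝ) + 1 ≤ (j : ℕ) := by exact_mod_cast hij
  nlinarith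

/-! ### Symmetric spaces: doubling of indicators and bounded functions -/

namespace SymmetricSpace

variable (X : SymmetricSpace)

theorem indicator_mem_of_le {A B : Set ℝ} (hA : MeasurableSet A)
    (hB : (B.indicator fun _ => (1 : ℝ)) ∈ X.space) (hAB : A ⊆ B) :
    (A.indicator fun _ => (1 : ℝ)) ∈ X.space ∧
      X.norm (A.indicator fun _ => 1) ≤ X.norm (B.indicator fun _ => 1) := by
  refine X.ideal _ _ ((measurable_const.indicator hA).aemeasurable) hB (ae_of_all _ fun x => ?_)
  by_cases hx : x ∈ A
  · simp [hx, hAB hx]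
  · simp [hx]

theorem indicator_mem_of_measure_eq {A B : Set ℝ} (hB : MeasurableSet B)
    (hA : (A.indicator fun _ => (1 : ℝ)) ∈ X.space) (h : unitMeasure A = unitMeasure B) :
    (B.indicator fun _ => (1 : ℝ)) ∈ X.space ∧
      X.norm (A.indicator fun _ => 1) = X.norm (B.indicator fun _ => 1) :=
  X.symmetric _ _ hA ((measurable_const.indicator hB).aemeasurable)
    (absEquimeasurable_indicator h)

/-- The added piece `(u, v]` is no longer than `(0, u]`, so it is equimeasurable with an initial
part of it and its indicator has no larger norm. -/
theorem indicator_Ioc_double {u v : ℝ} (hu : 0 < u) (huv : u ≤ v) (hv : v ≤ 1) (h2 : v ≤ 2 * u)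
    (h : ((Ioc 0 u).indicator fun _ => (1 : ℝ)) ∈ X.space) :
    ((Ioc 0 v).indicator fun _ => (1 : ℝ)) ∈ X.space ∧
      X.norm ((Ioc 0 v).indicator fun _ => 1) ≤ 2 * X.norm ((Ioc 0 u).indicator fun _ => 1) := by
  obtain ⟨h3, h4⟩ := X.indicator_mem_of_le (measurableSet_Ioc (a := 0) (b := v - u)) h
    (Ioc_subset_Ioc_right (by linarith))
  obtain ⟨h5, h6⟩ := X.indicator_mem_of_measure_eq (measurableSet_Ioc (a := u) (b := v)) h3 (by
    rw [unitMeasure_apply_of_subset, unitMeasure_apply_of_subset] <;>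
      first | simp | (intro x hx; exact ⟨by linarith [hx.1], by linarith [hx.2]⟩))
  have hsum : ((Ioc 0 v).indicator fun _ => (1 : ℝ)) =
      ((Ioc 0 u).indicator fun _ => (1 : ℝ)) + (Ioc u v).indicator fun _ => (1 : ℝ) := by
    rw [← Ioc_union_Ioc_eq_Ioc hu.le huv, Set.indicator_union_of_disjoint]
    · rfl
    · exact Set.Ioc_disjoint_Ioc_of_le le_rfl
  rw [hsum]
  refine ⟨X.space.add_mem h h5, ?_⟩
  have := X.norm_add_le _ h _ h5
  linarith

theorem indicator_Ioc_two_pow (k : ℕ) {u v : ℝ} (hu : 0 < u) (huv : u ≤ v) (hv : v ≤ 1)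
    (h2 : v ≤ 2 ^ k * u) (h : ((Ioc 0 u).indicator fun _ => (1 : ℝ)) ∈ X.space) :
    ((Ioc 0 v).indicator fun _ => (1 : ℝ)) ∈ X.space ∧
      X.norm ((Ioc 0 v).indicator fun _ => 1) ≤
        2 ^ k * X.norm ((Ioc 0 u).indicator fun _ => 1) := by
  induction k generalizing v with
  | zero =>
    obtain rfl : u = v := le_antisymm huv (by simpa using h2)
    simpa using h
  | succ k ih =>
    have h2' : v / 2 ≤ 2 ^ k * u := by rw [pow_succ] at h2; linarith
    -- The maximum with `u` keeps the intermediate endpoint at least `u` when `v / 2 < u`.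
    obtain ⟨h3, h4⟩ := ih (v := max u (v / 2)) (le_max_left _ _)
      (max_le (huv.trans hv) (by linarith))
      (max_le (le_mul_of_one_le_left hu.le (one_le_pow₀ one_le_two)) h2')
    obtain ⟨h5, h6⟩ := X.indicator_Ioc_double (v := v) (lt_max_of_lt_left hu)
      (max_le huv (by linarith)) hv (by linarith [le_max_right u (v / 2)]) h3
    refine ⟨h5, h6.trans ?_⟩
    rw [pow_succ]; linarith

/-- A nonzero element exceeds some `δ > 0` in modulus on a set of positive measure `a`. The
indicator of that set, hence of `(0, a]`, lies in the space, and finitely many doublings reach `(0,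
1]`. -/
theorem one_mem : (fun _ => (1 : ℝ)) ∈ X.space := by
  obtain ⟨f, hf, hf0⟩ := X.nontrivial
  have hfm := X.aemeasurable_of_mem f hf
  obtain ⟨g, hg, hfg⟩ : ∃ g, Measurable g ∧ f =ᵐ[unitMeasure] g := ⟨_, hfm.measurable_mk, hfm.ae_eq_mk⟩
  have hgX : g ∈ X.space :=
    (X.ideal g f hg.aemeasurable hf (hfg.mono fun x hx => by rw [hx])).1
  have hg0 : ¬ g =ᵐ[unitMeasure] 0 := fun h => hf0 (hfg.trans h)
  obtain ⟨n, hn⟩ : ∃ n : ℕ, unitMeasure {x | 1 / ((n : ℝ) + 1) < |g x|} ≠ 0 := by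
    by_contra! hcon
    apply hg0
    have := ae_all_iff.2 fun n => (measure_eq_zero_iff_ae_notMem.1 (hcon n))
    filter_upwards [this] with x hx
    by_contra hne
    obtain ⟨n, hn⟩ := exists_nat_one_div_lt (abs_pos.2 hne)
    exact hx n hn
  set δ : ℝ := 1 / ((n : ℝ) + 1)
  have hδ : 0 < δ := by positivity
  set A := {x | δ < |g x|}
  have hA : MeasurableSet A := measurableSet_lt measurable_const hg.abs
  have hAX : (A.indicator fun _ => (1 : ℝ)) ∈ X.space := by
    refine (X.ideal _ (δ⁻¹ • g) (measurable_const.indicator hA).aemeasurable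
      (X.space.smul_mem _ hgX) (ae_of_all _ fun x => ?_)).1
    by_cases hx : x ∈ A
    · have : δ < |g x| := hx
      simp only [hx, indicator_of_mem, abs_one, Pi.smul_apply, smul_eq_mul, abs_mul, abs_inv,
        abs_of_pos hδ]
      rw [inv_mul_eq_div, le_div_iff₀ hδ]; linarith
    · simp only [hx, not_false_eq_true, indicator_of_notMem, abs_zero]
      positivity
  have ha1 : unitMeasure A ≤ 1 := prob_le_one
  set a := (unitMeasure A).toReal
  have ha : 0 < a := ENNReal.toReal_pos hn (ne_top_of_le_ne_top ENNReal.one_ne_top ha1)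
  have ha1' : a ≤ 1 := ENNReal.toReal_le_of_le_ofReal zero_le_one (by simpa using ha1)
  have hIa : ((Ioc 0 a).indicator fun _ => (1 : ℝ)) ∈ X.space := by
    refine (X.indicator_mem_of_measure_eq measurableSet_Ioc hAX ?_).1
    rw [unitMeasure_apply_of_subset (s := Ioc 0 a)
      (Ioc_subset_Icc_self.trans (Icc_subset_Icc_right ha1')), Real.volume_Ioc, sub_zero,
      ENNReal.ofReal_toReal (ne_top_of_le_ne_top ENNReal.one_ne_top ha1)]
  obtain ⟨k, hk⟩ := pow_unbounded_of_one_lt (1 / a) one_lt_two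
  have h1 := (X.indicator_Ioc_two_pow k ha ha1' le_rfl
    (by rw [div_lt_iff₀ ha] at hk; exact hk.le) hIa).1
  refine (X.ideal _ _ aemeasurable_const h1 ?_).1
  filter_upwards [ae_unitMeasure_pos, ae_restrict_mem measurableSet_Icc] with x hx0 hx
  have : x ∈ Ioc (0 : ℝ) 1 := ⟨hx0, hx.2⟩
  simp [this]

theorem mem_of_bounded {f : ℝ → ℝ} (hf : AEMeasurable f unitMeasure) {c : ℝ}
    (h : ∀ᵐ x ∂unitMeasure, |f x| ≤ c) : f ∈ X.space := by
  refine (X.ideal f (c • fun _ => 1) hf (X.space.smul_mem _ X.one_mem) ?_).1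
  filter_upwards [h] with x hx
  simpa using hx.trans (le_abs_self c)

theorem norm_le_of_bounded {f : ℝ → ℝ} (hf : AEMeasurable f unitMeasure) {c : ℝ} (hc : 0 ≤ c)
    (h : ∀ᵐ x ∂unitMeasure, |f x| ≤ c) : X.norm f ≤ c * X.norm fun _ => 1 := by
  have := (X.ideal f (c • fun _ => 1) hf (X.space.smul_mem _ X.one_mem) (by
    filter_upwards [h] with x hx
    simpa using hx.trans (le_abs_self c))).2
  rwa [X.norm_smul _ _ X.one_mem, abs_of_nonneg hc] at this

theorem indicator_one_mem {A : Set ℝ} (hA : MeasurableSet A) :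
    (A.indicator fun _ => (1 : ℝ)) ∈ X.space :=
  X.mem_of_bounded (measurable_const.indicator hA).aemeasurable (c := 1) (ae_of_all _ fun x => by
    by_cases hx : x ∈ A <;> simp [hx])

theorem norm_indicator_Ioc_pos {s : ℝ} (hs : 0 < s) (hs1 : s ≤ 1) :
    0 < X.norm ((Ioc 0 s).indicator fun _ => 1) := by
  have hmem := X.indicator_one_mem (measurableSet_Ioc (a := 0) (b := s))
  refine lt_of_le_of_ne (X.norm_nonneg _ hmem) fun h => ?_
  have h0 := measure_mono_null (fun x (hx : x ∈ Ioc 0 s) => ?_)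
    (ae_iff.1 ((X.norm_eq_zero_iff _ hmem).1 h.symm))
  · rw [unitMeasure_apply_of_subset
      (Ioc_subset_Icc_self.trans (Icc_subset_Icc_right hs1))] at h0
    simp [hs.not_ge] at h0
  · simp only [mem_ofPred_eq, hx, indicator_of_mem]; simp

theorem norm_sum_le {ι : Type*} (t : Finset ι) (f : ι → ℝ → ℝ) (h : ∀ i ∈ t, f i ∈ X.space) :
    X.norm (∑ i ∈ t, f i) ≤ ∑ i ∈ t, X.norm (f i) := by
  classical
  induction t using Finset.induction with
  | empty =>
    have : X.norm 0 = 0 := (X.norm_eq_zero_iff 0 X.space.zero_mem).2 (by rfl)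
    simp [this]
  | insert i t hi ih =>
    rw [Finset.sum_insert hi, Finset.sum_insert hi]
    have h1 := X.norm_add_le (f i) (h i (Finset.mem_insert_self _ _)) (∑ j ∈ t, f j)
      (X.space.sum_mem fun j hj => h j (Finset.mem_insert_of_mem hj))
    have h2 := ih fun j hj => h j (Finset.mem_insert_of_mem hj)
    linarith

/-- The function with value `a i` on `B i`, for disjoint sets `B i`, and `0` elsewhere. -/
def stepFun {ι : Type*} [Fintype ι] (B : ι → Set ℝ) (a : ι → ℝ) (x : ℝ) : ℝ :=
  ∑ i, (B i).indicator (fun _ => a i) x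

/-! ### Averaging step functions over permutations -/

section step

variable {ι : Type*} [Fintype ι] {B : ι → Set ℝ}

theorem stepFun_of_mem (hd : Pairwise (Function.onFun Disjoint B)) (a : ι → ℝ) {i : ι} {x : ℝ}
    (hx : x ∈ B i) : stepFun B a x = a i := by
  rw [stepFun, Finset.sum_eq_single i]
  · simp [hx]
  · intro j _ hj
    have : x ∉ B j := fun h => Set.disjoint_left.1 (hd hj) h hx
    simp [this]
  · simp

theorem stepFun_of_notMem (a : ι → ℝ) {x : ℝ} (hx : ∀ i, x ∉ B i) : stepFun B a x = 0 := by
  simp [stepFun, hx]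

theorem measurable_stepFun (hB : ∀ i, MeasurableSet (B i)) (a : ι → ℝ) :
    Measurable (stepFun B a) :=
  Finset.measurable_fun_sum _ fun i _ => measurable_const.indicator (hB i)

theorem stepFun_mem (hB : ∀ i, MeasurableSet (B i)) (a : ι → ℝ) : stepFun B a ∈ X.space := by
  refine X.mem_of_bounded (measurable_stepFun hB a).aemeasurable (c := ∑ i, |a i|)
    (ae_of_all _ fun x => (Finset.abs_sum_le_sum_abs _ _).trans (Finset.sum_le_sum fun i _ => ?_))
  by_cases hx : x ∈ B i <;> simp [hx]

theorem unitMeasure_lt_stepFun (hB : ∀ i, MeasurableSet (B i))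
    (hd : Pairwise (Function.onFun Disjoint B)) (a : ι → ℝ) {l : ℝ} (hl : 0 < l) :
    unitMeasure {x | l < |stepFun B a x|} = ∑ i, if l < |a i| then unitMeasure (B i) else 0 := by
  have : {x | l < |stepFun B a x|} = ⋃ i ∈ Finset.univ.filter (fun i => l < |a i|), B i := by
    ext x
    simp only [mem_ofPred_eq, mem_iUnion, Finset.mem_filter, Finset.mem_univ, true_and, exists_prop]
    by_cases hx : ∃ i, x ∈ B i
    · obtain ⟨i, hi⟩ := hx
      rw [stepFun_of_mem hd a hi]
      refine ⟨fun h => ⟨i, h, hi⟩, fun ⟨j, h, hj⟩ => ?_⟩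
      obtain rfl : i = j := by
        by_contra hij
        exact Set.disjoint_left.1 (hd hij) hi hj
      exact h
    · push Not at hx
      rw [stepFun_of_notMem a hx]
      simp [hx, hl.le]
  rw [this, measure_biUnion_finset (fun i _ j _ hij => hd hij) fun i _ => hB i,
    Finset.sum_filter]

theorem norm_stepFun_perm (hB : ∀ i, MeasurableSet (B i))
    (hd : Pairwise (Function.onFun Disjoint B)) (heq : ∀ i j, unitMeasure (B i) = unitMeasure (B j))
    (a : ι → ℝ) (σ : Equiv.Perm ι) : X.norm (stepFun B fun i => a (σ i)) = X.norm (stepFun B a) := by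
  refine (X.symmetric _ _ (X.stepFun_mem hB _) (measurable_stepFun hB _).aemeasurable
    fun l hl => ?_).2
  rw [unitMeasure_lt_stepFun hB hd _ hl, unitMeasure_lt_stepFun hB hd _ hl,
    ← Equiv.sum_comp σ fun i => if l < |a i| then unitMeasure (B i) else 0]
  refine Finset.sum_congr rfl fun i _ => ?_
  rw [heq i (σ i)]

/-- The `N + 1` cyclic shifts of the values all have the same norm, and their sum is the constant `∑
a i` on the union of the cells; the triangle inequality concludes. -/
theorem sum_mul_norm_stepFun_one_le {N : ℕ} {B : Fin (N + 1) → Set ℝ}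
    (hB : ∀ i, MeasurableSet (B i)) (hd : Pairwise (Function.onFun Disjoint B))
    (heq : ∀ i j, unitMeasure (B i) = unitMeasure (B j)) (a : Fin (N + 1) → ℝ)
    (ha : ∀ i, 0 ≤ a i) :
    (∑ i, a i) * X.norm (stepFun B fun _ => 1) ≤ (N + 1) * X.norm (stepFun B a) := by
  have h1 : ∑ r : Fin (N + 1), stepFun B (fun i => a (Equiv.addRight r i)) =
      (∑ i, a i) • stepFun B fun _ => 1 := by
    ext x
    simp only [Finset.sum_apply, Pi.smul_apply, smul_eq_mul, stepFun]
    rw [Finset.sum_comm, Finset.mul_sum]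
    refine Finset.sum_congr rfl fun i _ => ?_
    by_cases hx : x ∈ B i
    · simp only [hx, indicator_of_mem, mul_one]
      exact Equiv.sum_comp (Equiv.addLeft i) a
    · simp [hx]
  have h2 := X.norm_sum_le Finset.univ (fun r : Fin (N + 1) =>
    stepFun B (fun i => a (Equiv.addRight r i))) fun r _ => X.stepFun_mem hB _
  rw [h1, X.norm_smul _ _ (X.stepFun_mem hB _),
    abs_of_nonneg (Finset.sum_nonneg fun i _ => ha i)] at h2
  simp_rw [X.norm_stepFun_perm hB hd heq a] at h2
  simpa using h2

end step

/-! ### The extended norm and the Marcinkiewicz embedding -/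

theorem extNorm_ne_top_iff {g : ℝ → ℝ≥0∞} : X.extNorm g ≠ ⊤ ↔
    (∀ᵐ t ∂unitMeasure, g t ≠ ∞) ∧ (fun t => (g t).toReal) ∈ X.space := by
  unfold extNorm
  split_ifs with h <;> simp [h]

theorem extNorm_eq_of_ne_top {g : ℝ → ℝ≥0∞} (h : X.extNorm g ≠ ⊤) :
    X.extNorm g = ENNReal.ofReal (X.norm fun t => (g t).toReal) := by
  rw [extNorm, if_pos (X.extNorm_ne_top_iff.1 h)]

theorem extNorm_mono {f g : ℝ → ℝ≥0∞} (hf : Measurable f) (h : f ≤ g) :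
    X.extNorm f ≤ X.extNorm g := by
  by_cases hg : X.extNorm g = ⊤
  · simp [hg]
  obtain ⟨h1, h2⟩ := X.extNorm_ne_top_iff.1 hg
  have h3 := X.ideal (fun t => (f t).toReal) _ hf.ennreal_toReal.aemeasurable h2 (by
    filter_upwards [h1] with t ht
    simpa using ENNReal.toReal_mono ht (h t))
  have hf' : X.extNorm f ≠ ⊤ := X.extNorm_ne_top_iff.2
    ⟨h1.mono fun t ht => ne_top_of_le_ne_top ht (h t), h3.1⟩
  rw [X.extNorm_eq_of_ne_top hg, X.extNorm_eq_of_ne_top hf']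
  exact ENNReal.ofReal_le_ofReal h3.2

theorem extNorm_le_of_bounded {f : ℝ → ℝ≥0∞} (hf : Measurable f) {c : ℝ≥0∞} (hc : c ≠ ⊤)
    (h : ∀ t, 0 < t → f t ≤ c) :
    X.extNorm f ≤ c * ENNReal.ofReal (X.norm fun _ => 1) := by
  have hpos := ae_unitMeasure_pos
  have hb : ∀ᵐ t ∂unitMeasure, |(f t).toReal| ≤ c.toReal := by
    filter_upwards [hpos] with t ht
    simpa using ENNReal.toReal_mono hc (h t ht)
  have hf' : X.extNorm f ≠ ⊤ := X.extNorm_ne_top_iff.2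
    ⟨hpos.mono fun t ht => ne_top_of_le_ne_top hc (h t ht),
      X.mem_of_bounded hf.ennreal_toReal.aemeasurable hb⟩
  rw [X.extNorm_eq_of_ne_top hf', ← ENNReal.ofReal_toReal hc,
    ← ENNReal.ofReal_mul ENNReal.toReal_nonneg]
  exact ENNReal.ofReal_le_ofReal
    (X.norm_le_of_bounded hf.ennreal_toReal.aemeasurable ENNReal.toReal_nonneg hb)

/-- A symmetric space embeds into the Marcinkiewicz space of its fundamental function. -/
theorem lintegral_Ioc_le_extNorm {g : ℝ → ℝ≥0∞} (hg : Antitone g) {s : ℝ} (hs : 0 < s)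
    (hs1 : s ≤ 1) :
    ∫⁻ x in Ioc 0 s, g x ≤
      ENNReal.ofReal (s / X.norm ((Ioc 0 s).indicator fun _ => 1)) * X.extNorm g := by
  have hpos := X.norm_indicator_Ioc_pos hs hs1
  by_cases htop : X.extNorm g = ⊤
  · rw [htop, ENNReal.mul_top]
    · exact le_top
    · simpa using div_pos hs hpos
  obtain ⟨hfin, hmem⟩ := X.extNorm_ne_top_iff.1 htop
  -- An infinite value at `t > 0` would force `g = ∞` on all of `(0, t]`, by monotonicity.
  have hfin' : ∀ t, 0 < t → g t ≠ ⊤ := by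
    intro t ht htt
    have h0 := measure_mono_null (fun x (hx : x ∈ Ioc 0 (min t 1)) => ?_) (ae_iff.1 hfin)
    · rw [unitMeasure_apply_of_subset
        (Ioc_subset_Icc_self.trans (Icc_subset_Icc_right (min_le_right _ _)))] at h0
      simp [ht.not_ge] at h0
    · have := hg (hx.2.trans (min_le_left _ _))
      rw [htt, top_le_iff] at this
      simpa using this
  -- `g` may be unbounded at `0`, so the integral is exhausted by the parts beyond one mesh `s / (N
  -- + 1)`.
  have hU : Ioc 0 s = ⋃ N : ℕ, Ioc (s / (N + 1)) s := by
    ext x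
    simp only [mem_iUnion, mem_Ioc]
    constructor
    · rintro ⟨h1, h2⟩
      obtain ⟨N, hN⟩ := exists_nat_one_div_lt (div_pos h1 hs)
      refine ⟨N, ?_, h2⟩
      rw [lt_div_iff₀ hs] at hN
      rwa [div_eq_mul_one_div, mul_comm]
    · rintro ⟨N, h1, h2⟩
      exact ⟨lt_trans (by positivity) h1, h2⟩
  have hdir : Monotone fun N : ℕ => Ioc (s / (N + 1)) s := by
    intro M N hMN
    apply Ioc_subset_Ioc_left
    gcongr
  have hsup : ∫⁻ x in Ioc 0 s, g x = ⨆ N : ℕ, ∫⁻ x in Ioc (s / (N + 1)) s, g x := by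
    rw [← setLIntegral_iUnion_of_directed _ hdir.directed_le, ← hU]
  rw [hsup]
  refine iSup_le fun N => ?_
  set d := s / (N + 1) with hd
  have hdpos : 0 < d := by positivity
  have hNd : (N + 1 : ℝ) * d = s := by rw [hd]; field_simp
  set B : Fin (N + 1) → Set ℝ := fun i => Ioc ((i : ℕ) * d) (((i : ℕ) + 1) * d)
  -- Values at right endpoints: the step function lies below `g`, so its norm is controlled by that
  -- of `g`.
  set a : Fin (N + 1) → ℝ := fun i => (g (((i : ℕ) + 1) * d)).toReal
  have hBm : ∀ i, MeasurableSet (B i) := fun i => measurableSet_Ioc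
  have hBd : Pairwise (Function.onFun Disjoint B) := pairwise_disjoint_Ioc_nat_mul hdpos
  have hBs : ∀ i, B i ⊆ Icc 0 1 := fun i x hx => by
    have := (exists_mem_Ioc_mul_iff hdpos).1 ⟨i, hx⟩
    rw [hNd] at this
    exact ⟨this.1.le, this.2.trans hs1⟩
  have hBe : ∀ i, unitMeasure (B i) = ENNReal.ofReal d := fun i => by
    rw [unitMeasure_apply_of_subset (hBs i), Real.volume_Ioc]; ring_nf
  have hone : (stepFun B fun _ => 1) = (Ioc 0 s).indicator fun _ => 1 := by
    ext x
    by_cases hx : x ∈ Ioc 0 s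
    · obtain ⟨i, hi⟩ := (exists_mem_Ioc_mul_iff (N := N) hdpos).2 (by rwa [hNd])
      rw [stepFun_of_mem hBd _ hi, indicator_of_mem hx]
    · rw [indicator_of_notMem hx, stepFun_of_notMem]
      intro i hi
      apply hx
      rw [← hNd]
      exact (exists_mem_Ioc_mul_iff hdpos).1 ⟨i, hi⟩
  have hstep : X.norm (stepFun B a) ≤ X.norm fun t => (g t).toReal := by
    refine (X.ideal _ _ (measurable_stepFun hBm a).aemeasurable hmem (ae_of_all _ fun x => ?_)).2
    by_cases hx : ∃ i, x ∈ B i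
    · obtain ⟨i, hi⟩ := hx
      have hx0 : 0 < x := lt_of_le_of_lt (by positivity) hi.1
      rw [stepFun_of_mem hBd _ hi, abs_of_nonneg ENNReal.toReal_nonneg,
        abs_of_nonneg ENNReal.toReal_nonneg]
      exact ENNReal.toReal_mono (hfin' x hx0) (hg hi.2)
    · push Not at hx
      simp [stepFun_of_notMem a hx]
  have hmain := X.sum_mul_norm_stepFun_one_le hBm hBd (fun i j => by rw [hBe, hBe]) a
    fun i => ENNReal.toReal_nonneg
  rw [hone] at hmain
  -- Cells shifted by one mesh: on the shifted cell `g` is at most its left-endpoint value, which is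
  -- `a i`. The lower sum on `(0, s]` thus serves as an upper sum on `(d, s]`; the overshoot beyond
  -- `s` is harmless.
  have hcover : Ioc d s ⊆ ⋃ i : Fin (N + 1), Ioc (((i : ℕ) + 1) * d) (((i : ℕ) + 2) * d) := by
    rintro x ⟨h1, h2⟩
    obtain ⟨i, hi1, hi2⟩ := (exists_mem_Ioc_mul_iff (N := N) (x := x - d) hdpos).2
      ⟨by linarith, by linarith⟩
    exact mem_iUnion.2 ⟨i, by linarith, by linarith⟩
  calc ∫⁻ x in Ioc d s, g x
      ≤ ∫⁻ x in ⋃ i : Fin (N + 1), Ioc (((i : ℕ) + 1) * d) (((i : ℕ) + 2) * d), g x :=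
        lintegral_mono_set hcover
    _ ≤ ∑' i : Fin (N + 1), ∫⁻ x in Ioc (((i : ℕ) + 1) * d) (((i : ℕ) + 2) * d), g x :=
        lintegral_iUnion_le _ _
    _ ≤ ∑ i : Fin (N + 1), ENNReal.ofReal (a i * d) := by
        rw [tsum_fintype]
        refine Finset.sum_le_sum fun i _ => ?_
        calc _ ≤ ∫⁻ x in Ioc ((((i : ℕ) : ℝ) + 1) * d) (((i : ℕ) + 2) * d), ENNReal.ofReal (a i) := by
              refine setLIntegral_mono measurable_const fun x hx => ?_
              rw [ENNReal.ofReal_toReal (hfin' _ (by positivity))]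
              exact hg hx.1.le
          _ = _ := by
              rw [setLIntegral_const, Real.volume_Ioc, ENNReal.ofReal_mul ENNReal.toReal_nonneg]
              congr 2
              ring
    _ = ENNReal.ofReal ((∑ i, a i) * d) := by
        rw [Finset.sum_mul, ENNReal.ofReal_sum_of_nonneg]
        exact fun i _ => mul_nonneg ENNReal.toReal_nonneg hdpos.le
    _ ≤ ENNReal.ofReal (s / X.norm ((Ioc 0 s).indicator fun _ => 1) *
          X.norm fun t => (g t).toReal) := by
        apply ENNReal.ofReal_le_ofReal
        rw [div_mul_eq_mul_div, le_div_iff₀ hpos]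
        calc (∑ i, a i) * d * X.norm ((Ioc 0 s).indicator fun _ => 1)
            = ((∑ i, a i) * X.norm ((Ioc 0 s).indicator fun _ => 1)) * d := by ring
          _ ≤ ((N + 1) * X.norm fun t => (g t).toReal) * d := by
              have : (0 : ℝ) ≤ N + 1 := by positivity
              exact mul_le_mul_of_nonneg_right
                (hmain.trans (mul_le_mul_of_nonneg_left hstep this)) hdpos.le
          _ = _ := by rw [← hNd]; ring
    _ = _ := by
        rw [X.extNorm_eq_of_ne_top htop, ENNReal.ofReal_mul (by positivity)]

end SymmetricSpace

/-! ### Iterated integrals against iterated norms -/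

theorem Antitone.comp_update {F : (Fin m → ℝ) → ℝ≥0∞} (hF : Antitone F) (t : Fin m → ℝ)
    (j : Fin m) : Antitone fun s => F (Function.update t j s) :=
  fun _ _ h => hF (update_le_update_iff'.2 h)

theorem update_mono_left {s t : Fin m → ℝ} (h : s ≤ t) (j : Fin m) (x : ℝ) :
    Function.update s j x ≤ Function.update t j x :=
  update_le_update_iff.2 ⟨le_rfl, fun i _ => h i⟩

/-- Joint monotonicity passes through a norm in one variable. It makes all slices measurable and
keeps the Marcinkiewicz bound applicable to the next variable. -/
theorem antitone_normAt (X : SymmetricSpace) (j : Fin m) {F : (Fin m → ℝ) → ℝ≥0∞}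
    (hF : Antitone F) : Antitone (normAt X j F) := fun _ t h =>
  X.extNorm_mono (hF.comp_update t j).measurable fun x => hF (update_mono_left h j x)

/-- Integration in the variable `j` with respect to `ν j`, the other variables being fixed. -/
def integrateAt (ν : Fin m → Measure ℝ) (j : Fin m) (F : (Fin m → ℝ) → ℝ≥0∞) :
    (Fin m → ℝ) → ℝ≥0∞ :=
  fun t => ∫⁻ s, F (Function.update t j s) ∂ν j

theorem foldl_integrateAt_mono (ν : Fin m → Measure ℝ) (L : List (Fin m))
    {F G : (Fin m → ℝ) → ℝ≥0∞} (h : F ≤ G) :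
    L.foldl (fun F j => integrateAt ν j F) F ≤ L.foldl (fun F j => integrateAt ν j F) G := by
  induction L generalizing F G with
  | nil => exact h
  | cons j L ih => exact ih fun t => lintegral_mono fun s => h _

theorem foldl_integrateAt_const_mul (ν : Fin m → Measure ℝ) (L : List (Fin m))
    (F : (Fin m → ℝ) → ℝ≥0∞) {c : ℝ≥0∞} (hc : c ≠ ⊤) :
    L.foldl (fun F j => integrateAt ν j F) (fun t => c * F t) =
      fun t => c * L.foldl (fun F j => integrateAt ν j F) F t := by
  induction L generalizing F with
  | nil => rfl
  | cons j L ih =>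
    simp only [List.foldl_cons]
    rw [← ih]
    congr 1
    ext t
    exact lintegral_const_mul' _ _ hc

theorem foldl_integrateAt_le_foldl_normAt (X : Fin m → SymmetricSpace) (ν : Fin m → Measure ℝ)
    {c : Fin m → ℝ≥0∞} (hc : ∀ j, c j ≠ ⊤)
    (h : ∀ j, ∀ g : ℝ → ℝ≥0∞, Antitone g → ∫⁻ s, g s ∂ν j ≤ c j * (X j).extNorm g)
    (L : List (Fin m)) {F : (Fin m → ℝ) → ℝ≥0∞} (hF : Antitone F) (t : Fin m → ℝ) :
    L.foldl (fun F j => integrateAt ν j F) F t ≤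
      (L.map c).prod * L.foldl (fun F j => normAt (X j) j F) F t := by
  induction L generalizing F t with
  | nil => simp
  | cons j L ih =>
    simp only [List.foldl_cons, List.map_cons, List.prod_cons]
    calc L.foldl (fun F j => integrateAt ν j F) (integrateAt ν j F) t
        ≤ L.foldl (fun F j => integrateAt ν j F) (fun t => c j * normAt (X j) j F t) t :=
          foldl_integrateAt_mono ν L (fun t => h j _ (hF.comp_update t j)) t
      _ = c j * L.foldl (fun F j => integrateAt ν j F) (normAt (X j) j F) t := by
          rw [foldl_integrateAt_const_mul ν L _ (hc j)]
      _ ≤ c j * ((L.map c).prod * L.foldl (fun F j => normAt (X j) j F) (normAt (X j) j F) t) := by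
          gcongr
          exact ih (antitone_normAt _ _ hF) t
      _ = _ := by ring

/-- Each norm multiplies a uniform bound by the norm of the constant `1`. -/
theorem foldl_normAt_lt_top (X : Fin m → SymmetricSpace) (L : List (Fin m))
    {F : (Fin m → ℝ) → ℝ≥0∞} (hF : Antitone F) {c : ℝ≥0∞} (hc : c ≠ ⊤)
    (h : ∀ t : Fin m → ℝ, (∀ j ∈ L, 0 < t j) → F t ≤ c) (t : Fin m → ℝ) :
    L.foldl (fun F j => normAt (X j) j F) F t < ⊤ := by
  induction L generalizing F c with
  | nil => exact (h t (by simp)).trans_lt hc.lt_top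
  | cons j L ih =>
    refine ih (antitone_normAt _ _ hF)
      (c := c * ENNReal.ofReal ((X j).norm fun _ => 1)) (by finiteness) fun t ht => ?_
    refine (X j).extNorm_le_of_bounded (hF.comp_update t j).measurable hc fun s hs => h _ ?_
    intro i hi
    by_cases hij : i = j
    · subst hij; simpa using hs
    · rw [Function.update_of_ne hij]
      exact ht i ((List.mem_cons.1 hi).resolve_left hij)

theorem foldl_integrateAt_eq_lmarginal (ν : Fin m → Measure ℝ) [∀ j, SigmaFinite (ν j)]
    (L : List (Fin m)) (hL : L.Nodup) {F : (Fin m → ℝ) → ℝ≥0∞} (hF : Measurable F) :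
    L.foldl (fun F j => integrateAt ν j F) F = lmarginal ν L.toFinset F := by
  induction L generalizing F with
  | nil => simp
  | cons j L ih =>
    obtain ⟨h1, h2⟩ := List.nodup_cons.1 hL
    have hm : Measurable (integrateAt ν j F) := by
      have := hF.lmarginal ν (s := {j})
      rwa [lmarginal_singleton] at this
    rw [List.foldl_cons, ih h2 hm, List.toFinset_cons, lmarginal_insert' _ hF (by simpa using h1)]
    rfl

/-! ### Rearrangements -/

theorem antitone_rearrangement (g : ℝ → ℝ≥0∞) : Antitone (rearrangement g) := fun _ _ h =>
  sInf_le_sInf fun _ hl => ⟨hl.1, hl.2.trans_le (ENNReal.ofReal_le_ofReal h)⟩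

theorem rearrangement_mono {f g : ℝ → ℝ≥0∞} (h : f ≤ g) (t : ℝ) :
    rearrangement f t ≤ rearrangement g t :=
  sInf_le_sInf fun _ hl => ⟨hl.1, (measure_mono fun x hx => lt_of_lt_of_le hx (h x)).trans_lt hl.2⟩

/-- `c ≠ 0` is needed because only positive levels are admitted in `rearrangement`. -/
theorem rearrangement_le_of_bounded {g : ℝ → ℝ≥0∞} {c : ℝ≥0∞} (hc : c ≠ 0)
    (h : ∀ᵐ x ∂unitMeasure, g x ≤ c) {t : ℝ} (ht : 0 < t) : rearrangement g t ≤ c := by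
  refine sInf_le ⟨pos_iff_ne_zero.2 hc, ?_⟩
  have : unitMeasure {x | c < g x} = 0 := measure_mono_null (fun x hx => not_le.2 hx) (ae_iff.1 h)
  simpa [this] using ht

/-- Restricting to rational levels makes sublevel sets countable unions, which gives joint
measurability of `rearrangeAt`. -/
theorem rearrangement_lt_iff {g : ℝ → ℝ≥0∞} {t : ℝ} {c : ℝ≥0∞} :
    rearrangement g t < c ↔ ∃ q : ℚ, 0 < q ∧ ENNReal.ofReal q < c ∧
      unitMeasure {x | ENNReal.ofReal q < g x} < ENNReal.ofReal t := by
  constructor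
  · intro h
    obtain ⟨l, ⟨hl0, hl⟩, hlc⟩ := sInf_lt_iff.1 h
    obtain ⟨q, -, hlq, hqc⟩ := ENNReal.lt_iff_exists_rat_btwn.1 hlc
    exact ⟨q, by simpa using hl0.trans hlq, hqc,
      (measure_mono fun x hx => hlq.trans hx).trans_lt hl⟩
  · rintro ⟨q, h1, h2, h3⟩
    have h4 : rearrangement g t ≤ ENNReal.ofReal q := sInf_le ⟨by simpa using h1, h3⟩
    exact h4.trans_lt h2

theorem measurable_update_prod (j : Fin m) :
    Measurable fun p : (Fin m → ℝ) × ℝ => Function.update p.1 j p.2 :=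
  measurable_pi_iff.2 fun i => by
    by_cases h : i = j
    · subst h; simpa using measurable_snd
    · simpa [h] using measurable_fst.eval (a := i)

theorem measurable_rearrangeAt (j : Fin m) {F : (Fin m → ℝ) → ℝ≥0∞} (hF : Measurable F) :
    Measurable (rearrangeAt j F) := by
  refine measurable_of_Iio fun c => ?_
  have : rearrangeAt j F ⁻¹' Iio c = ⋃ q : ℚ, {t | 0 < q ∧ ENNReal.ofReal q < c ∧
      unitMeasure {x | ENNReal.ofReal q < F (Function.update t j x)} <
        ENNReal.ofReal (t j)} := by
    ext t
    simp only [mem_preimage, mem_Iio, mem_iUnion, mem_ofPred_eq, rearrangeAt]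
    exact rearrangement_lt_iff
  rw [this]
  refine MeasurableSet.iUnion fun q => (MeasurableSet.const _).inter
    ((MeasurableSet.const _).inter ?_)
  refine measurableSet_lt ?_ (measurable_pi_apply j).ennreal_ofReal
  have hS : MeasurableSet {p : (Fin m → ℝ) × ℝ |
      ENNReal.ofReal q < F (Function.update p.1 j p.2)} :=
    measurableSet_lt measurable_const (hF.comp (measurable_update_prod j))
  exact measurable_measure_prodMk_left hS

/-- Layer-cake comparison. The formula is used for real-valued functions, so both sides are
truncated at `n` and `n → ∞` by monotone convergence. The mix of strict and weak level sets is the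
form that rearrangements satisfy directly. -/
theorem lintegral_le_of_measure_lt_le {α β : Type*} [MeasurableSpace α] [MeasurableSpace β]
    {μ : Measure α} {ν : Measure β} {f : α → ℝ≥0∞} {g : β → ℝ≥0∞} (hf : Measurable f)
    (hg : Measurable g) (h : ∀ l, 0 < l → l ≠ ⊤ → μ {x | l < f x} ≤ ν {x | l ≤ g x}) :
    ∫⁻ x, f x ∂μ ≤ ∫⁻ x, g x ∂ν := by
  have key : ∀ n : ℕ, ∫⁻ x, min (f x) n ∂μ ≤ ∫⁻ x, g x ∂ν := by
    intro n
    have h1 : ∫⁻ x, min (f x) n ∂μ = ∫⁻ x, ENNReal.ofReal (min (f x) n).toReal ∂μ := by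
      simp
    have h2 : ∫⁻ x, ENNReal.ofReal (min (g x) n).toReal ∂ν ≤ ∫⁻ x, g x ∂ν :=
      lintegral_mono fun x => by simp
    refine h1.trans_le (le_trans ?_ h2)
    rw [lintegral_eq_lintegral_meas_lt μ (ae_of_all _ fun x => ENNReal.toReal_nonneg)
        (by fun_prop), lintegral_eq_lintegral_meas_le ν
        (ae_of_all _ fun x => ENNReal.toReal_nonneg) (by fun_prop)]
    refine setLIntegral_mono' measurableSet_Ioi fun l hl => ?_
    have hl : 0 < l := hl
    have h3 : ∀ y : ℝ≥0∞, l < (min y (n : ℝ≥0∞)).toReal → ENNReal.ofReal l < y ∧ l < n := by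
      intro y hy
      rw [← ENNReal.ofReal_lt_iff_lt_toReal hl.le (by simp), lt_min_iff] at hy
      refine ⟨hy.1, ?_⟩
      have := hy.2
      rwa [← ENNReal.ofReal_natCast, ENNReal.ofReal_lt_ofReal_iff_of_nonneg hl.le] at this
    by_cases hln : l < n
    · refine (measure_mono fun x hx => (h3 _ hx).1).trans
        ((h (ENNReal.ofReal l) (by simpa using hl) (by simp)).trans (measure_mono fun x hx => ?_))
      have hx : ENNReal.ofReal l ≤ g x := hx
      change l ≤ (min (g x) n).toReal
      rw [← ENNReal.ofReal_le_iff_le_toReal (by simp)]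
      refine le_min hx ?_
      rw [← ENNReal.ofReal_natCast]
      exact ENNReal.ofReal_le_ofReal hln.le
    · refine (measure_mono_null (fun x hx => hln (h3 _ hx).2) (measure_empty (μ := μ))).trans_le ?_
      exact zero_le
  have hsup : ∀ x, f x = ⨆ n : ℕ, min (f x) n := by
    intro x
    rw [← inf_iSup_eq, ENNReal.iSup_natCast]; simp
  calc ∫⁻ x, f x ∂μ = ∫⁻ x, ⨆ n : ℕ, min (f x) n ∂μ := lintegral_congr hsup
    _ = ⨆ n : ℕ, ∫⁻ x, min (f x) n ∂μ := by
        refine lintegral_iSup (fun n => by fun_prop) fun a b hab x => ?_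
        exact min_le_min le_rfl (by exact_mod_cast hab)
    _ ≤ _ := iSup_le key

/-- The Hardy–Littlewood rearrangement inequality for the integral over a set. -/
theorem setLIntegral_le_rearrangement {f : ℝ → ℝ≥0∞} (hf : Measurable f) {A : Set ℝ}
    (hA : A ⊆ Icc 0 1) :
    ∫⁻ x in A, f x ≤ ∫⁻ t in Ioc 0 (volume.real A), rearrangement f t := by
  have hAfin : volume A ≠ ⊤ := measure_ne_top_of_subset hA (by simp)
  refine lintegral_le_of_measure_lt_le hf (antitone_rearrangement f).measurable
    fun l hl hlt => ?_
  rw [Measure.restrict_apply (measurableSet_lt measurable_const hf)]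
  set b := volume ({x | l < f x} ∩ A) with hb
  have hbA : b ≤ volume A := measure_mono inter_subset_right
  have hbfin : b ≠ ⊤ := ne_top_of_le_ne_top hAfin hbA
  have hbu : b ≤ unitMeasure {x | l < f x} := by
    rw [unitMeasure, Measure.restrict_apply (measurableSet_lt measurable_const hf)]
    exact measure_mono (inter_subset_inter_right _ hA)
  -- The rearrangement is at least `l` on `(0, b]`: a level `k < l` admissible at `t ≤ b` would give
  -- `b ≤ |{f > k}| < t`.
  calc b = volume (Ioc 0 b.toReal) := by rw [Real.volume_Ioc, sub_zero, ENNReal.ofReal_toReal hbfin]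
    _ ≤ _ := by
        rw [← Measure.restrict_eq_self volume
          (Ioc_subset_Ioc_right (ENNReal.toReal_mono hAfin hbA) : Ioc 0 b.toReal ⊆ _)]
        refine measure_mono fun t ht => (le_sInf fun k hk => ?_ : l ≤ rearrangement f t)
        by_contra hkl
        push Not at hkl
        have h1 : unitMeasure {x | l < f x} ≤ unitMeasure {x | k < f x} :=
          measure_mono fun x hx => hkl.trans hx
        have h2 : ENNReal.ofReal t ≤ b := by
          rw [← ENNReal.ofReal_toReal hbfin]; exact ENNReal.ofReal_le_ofReal ht.2
        exact absurd hk.2 (not_lt.2 (h2.trans (hbu.trans h1)))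

/-! ### Iterated rearrangements -/

/-- `S` collects the variables already rearranged. Monotonicity in them survives because
rearrangement preserves order between functions; monotonicity in `j` is gained. -/
theorem rearrangeAt_antitone_on {j : Fin m} {S : Set (Fin m)} {F : (Fin m → ℝ) → ℝ≥0∞}
    (hF : ∀ s t, s ≤ t → (∀ i ∉ S, s i = t i) → F t ≤ F s) :
    ∀ s t, s ≤ t → (∀ i ∉ insert j S, s i = t i) → rearrangeAt j F t ≤ rearrangeAt j F s := by
  intro s t hst heq
  refine (rearrangement_mono (fun x => ?_) _).trans (antitone_rearrangement _ (hst j))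
  refine hF _ _ (update_mono_left hst j x) fun i hi => ?_
  by_cases hij : i = j
  · subst hij; simp
  · simp [hij, heq i (by simp [hij, hi])]

theorem foldl_rearrangeAt_antitone_on (L : List (Fin m)) {S : Set (Fin m)}
    {F : (Fin m → ℝ) → ℝ≥0∞} (hF : ∀ s t, s ≤ t → (∀ i ∉ S, s i = t i) → F t ≤ F s) :
    ∀ s t, s ≤ t → (∀ i, i ∉ S → i ∉ L → s i = t i) →
      L.foldl (fun F j => rearrangeAt j F) F t ≤ L.foldl (fun F j => rearrangeAt j F) F s := by
  induction L generalizing F S with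
  | nil => simpa using hF
  | cons j L ih =>
    intro s t hst heq
    refine ih (rearrangeAt_antitone_on hF) s t hst fun i hi hL => heq i ?_ ?_
    · exact fun h => hi (mem_insert_of_mem _ h)
    · rintro (_ | ⟨_, h⟩)
      · exact hi (mem_insert _ _)
      · exact hL h

theorem antitone_foldl_rearrangeAt_finRange (F : (Fin m → ℝ) → ℝ≥0∞) :
    Antitone ((List.finRange m).foldl (fun F j => rearrangeAt j F) F) := fun s t h =>
  foldl_rearrangeAt_antitone_on (List.finRange m) (S := ∅)
    (fun s t _ h2 => by rw [funext fun i => h2 i (notMem_empty i)]) s t h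
    fun i _ hi => absurd (List.mem_finRange i) hi

theorem foldl_rearrangeAt_le_of_bounded (L : List (Fin m)) {F : (Fin m → ℝ) → ℝ≥0∞} {c : ℝ≥0∞}
    (hc : c ≠ 0) (h : ∀ t : Fin m → ℝ, (∀ i, 0 < t i) → F t ≤ c) :
    ∀ t : Fin m → ℝ, (∀ i, 0 < t i) → L.foldl (fun F j => rearrangeAt j F) F t ≤ c := by
  induction L generalizing F with
  | nil => exact h
  | cons j L ih =>
    refine ih fun t ht => rearrangement_le_of_bounded hc ?_ (ht j)
    filter_upwards [ae_unitMeasure_pos] with x hx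
    refine h _ fun i => ?_
    by_cases hij : i = j
    · subst hij; simpa using hx
    · simpa [hij] using ht i

theorem measurable_foldl_rearrangeAt (L : List (Fin m)) {F : (Fin m → ℝ) → ℝ≥0∞}
    (hF : Measurable F) : Measurable (L.foldl (fun F j => rearrangeAt j F) F) := by
  induction L generalizing F with
  | nil => exact hF
  | cons j L ih => exact ih (measurable_rearrangeAt j hF)

/-! ### Slicing product measures -/

instance sigmaFinite_update (μ : Fin m → Measure ℝ) [∀ i, SigmaFinite (μ i)] (j : Fin m)
    (ν : Measure ℝ) [SigmaFinite ν] (i : Fin m) : SigmaFinite (Function.update μ j ν i) := by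
  by_cases h : i = j
  · subst h; simpa
  · simpa [h] using inferInstanceAs (SigmaFinite (μ i))

/-- Coordinate `j` of the first factor is overwritten, so its total mass `1` drops out. With a dummy
probability measure there, Tonelli in one variable needs no change of index set. -/
theorem map_update_pi_prod (μ : Fin m → Measure ℝ) [∀ i, SigmaFinite (μ i)] (j : Fin m)
    (hμ : μ j univ = 1) (ν : Measure ℝ) [SigmaFinite ν] :
    Measure.map (fun p : (Fin m → ℝ) × ℝ => Function.update p.1 j p.2)
      ((Measure.pi μ).prod ν) = Measure.pi (Function.update μ j ν) := by
  symm
  refine Measure.pi_eq fun s hs => ?_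
  rw [Measure.map_apply (measurable_update_prod j) (MeasurableSet.univ_pi hs)]
  have : (fun p : (Fin m → ℝ) × ℝ => Function.update p.1 j p.2) ⁻¹' univ.pi s =
      (univ.pi (Function.update s j univ)) ×ˢ s j := by
    ext ⟨x, u⟩
    simp only [mem_preimage, mem_univ_pi, mem_prod]
    constructor
    · refine fun h => ⟨fun i => ?_, by simpa using h j⟩
      by_cases hij : i = j
      · subst hij; simp
      · simpa [hij] using h i
    · rintro ⟨h, h2⟩ i
      by_cases hij : i = j
      · subst hij; simpa using h2
      · simpa [hij] using h i
  rw [this, Measure.prod_prod, Measure.pi_pi, ← Finset.mul_prod_erase _ _ (Finset.mem_univ j),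
    ← Finset.mul_prod_erase _ (fun i => Function.update μ j ν i (s i)) (Finset.mem_univ j)]
  simp only [Function.update_self, hμ, one_mul]
  rw [mul_comm]
  congr 1
  refine Finset.prod_congr rfl fun i hi => ?_
  simp [Finset.ne_of_mem_erase hi]

/-- The product of Lebesgue measure on the sets `A i`, `i ≠ j`, and on `[0, 1]` in the
variable `j`. -/
def baseMeasure (A : Fin m → Set ℝ) (j : Fin m) : Measure (Fin m → ℝ) :=
  Measure.pi (Function.update (fun i => volume.restrict (A i)) j unitMeasure)

instance (A : Fin m → Set ℝ) (j : Fin m) : SFinite (baseMeasure A j) := by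
  unfold baseMeasure; infer_instance

theorem setLIntegral_pi_update (A : Fin m → Set ℝ) (j : Fin m) (B : Set ℝ)
    {f : (Fin m → ℝ) → ℝ≥0∞} (hf : Measurable f) :
    ∫⁻ x in univ.pi (Function.update A j B), f x =
      ∫⁻ x, (∫⁻ u in B, f (Function.update x j u)) ∂baseMeasure A j := by
  have h1 : (volume : Measure (Fin m → ℝ)).restrict (univ.pi (Function.update A j B)) =
      Measure.pi (Function.update (Function.update (fun i => volume.restrict (A i)) j unitMeasure) j
        (volume.restrict B)) := by
    rw [volume_pi, Measure.restrict_pi_pi]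
    congr 1
    ext1 i
    by_cases hij : i = j
    · subst hij; simp
    · simp [hij]
  rw [h1, ← map_update_pi_prod _ j (by simp), lintegral_map hf (measurable_update_prod j)]
  exact lintegral_prod _ (hf.comp (measurable_update_prod j)).aemeasurable

theorem setLIntegral_pi_eq (A : Fin m → Set ℝ) (j : Fin m)
    {f : (Fin m → ℝ) → ℝ≥0∞} (hf : Measurable f) :
    ∫⁻ x in univ.pi A, f x =
      ∫⁻ x, (∫⁻ u in A j, f (Function.update x j u)) ∂baseMeasure A j := by
  rw [← setLIntegral_pi_update A j (A j) hf, Function.update_eq_self]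

theorem setLIntegral_pi_le_rearrangeAt {A : Fin m → Set ℝ} {j : Fin m} (hA : A j ⊆ Icc 0 1)
    {F : (Fin m → ℝ) → ℝ≥0∞} (hF : Measurable F) :
    ∫⁻ x in univ.pi A, F x ≤
      ∫⁻ x in univ.pi (Function.update A j (Ioc 0 (volume.real (A j)))), rearrangeAt j F x := by
  rw [setLIntegral_pi_eq A j hF, setLIntegral_pi_update A j _ (measurable_rearrangeAt j hF)]
  refine lintegral_mono fun x => ?_
  simp only [rearrangeAt, Function.update_idem, Function.update_self]
  exact setLIntegral_le_rearrangement (hF.comp (measurable_update x)) hA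

theorem volume_real_mem_Icc {A : Set ℝ} (hA : A ⊆ Icc 0 1) : volume.real A ∈ Icc (0 : ℝ) 1 := by
  refine ⟨measureReal_nonneg, ?_⟩
  have := measureReal_mono (μ := volume) hA (by simp)
  simpa using this

/-- Hardy–Littlewood in one coordinate at a time: each step turns one side of the box into an
initial interval of equal measure. -/
theorem exists_setLIntegral_pi_le_foldl_rearrangeAt (L : List (Fin m)) {A : Fin m → Set ℝ}
    (hA : ∀ j, A j ⊆ Icc 0 1) {F : (Fin m → ℝ) → ℝ≥0∞} (hF : Measurable F) :
    ∃ A' : Fin m → Set ℝ, (∀ j ∈ L, A' j = Ioc 0 (volume.real (A j))) ∧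
      (∀ j ∉ L, A' j = A j) ∧ ∫⁻ x in univ.pi A, F x ≤
        ∫⁻ x in univ.pi A', L.foldl (fun F j => rearrangeAt j F) F x := by
  induction L generalizing F A with
  | nil => exact ⟨A, by simp, by simp, le_rfl⟩
  | cons j L ih =>
    have hv := volume_real_mem_Icc (hA j)
    have hsub : ∀ i, Function.update A j (Ioc 0 (volume.real (A j))) i ⊆ Icc 0 1 := by
      intro i
      by_cases hij : i = j
      · subst hij
        simpa using Ioc_subset_Icc_self.trans (Icc_subset_Icc_right hv.2)
      · simpa [hij] using hA i
    have hvol : ∀ i, volume.real (Function.update A j (Ioc 0 (volume.real (A j))) i) =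
        volume.real (A i) := by
      intro i
      by_cases hij : i = j
      · subst hij; simp
      · simp [hij]
    obtain ⟨A', h1, h2, h3⟩ := ih hsub (measurable_rearrangeAt j hF)
    refine ⟨A', fun i hi => ?_, fun i hi => ?_, (setLIntegral_pi_le_rearrangeAt (hA j) hF).trans h3⟩
    · by_cases hiL : i ∈ L
      · rw [h1 i hiL, hvol]
      · obtain rfl : i = j := (List.mem_cons.1 hi).resolve_right hiL
        rw [h2 i hiL]; simp
    · rw [List.mem_cons, not_or] at hi
      rw [h2 i hi.2]; simp [hi.1]

theorem setLIntegral_pi_le_foldl_normAt (X : Fin m → SymmetricSpace) {A : Fin m → Set ℝ}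
    (hA : ∀ j, A j ⊆ Icc 0 1) {F : (Fin m → ℝ) → ℝ≥0∞} (hF : Measurable F) (t : Fin m → ℝ) :
    ∫⁻ x in univ.pi A, F x ≤
      (∏ j, ENNReal.ofReal (volume.real (A j) /
        (X j).norm ((Ioc 0 (volume.real (A j))).indicator fun _ => 1))) *
      (List.finRange m).foldl (fun F j => normAt (X j) j F)
        ((List.finRange m).foldl (fun F j => rearrangeAt j F) F) t := by
  obtain ⟨A', h1, -, h3⟩ :=
    exists_setLIntegral_pi_le_foldl_rearrangeAt (List.finRange m) hA hF
  obtain rfl : A' = fun j => Ioc 0 (volume.real (A j)) :=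
    funext fun j => h1 j (List.mem_finRange j)
  refine h3.trans ?_
  set c : Fin m → ℝ≥0∞ := fun j => ENNReal.ofReal (volume.real (A j) /
    (X j).norm ((Ioc 0 (volume.real (A j))).indicator fun _ => 1))
  have hprod : ((List.finRange m).map c).prod = ∏ j, c j := by
    rw [← List.ofFn_eq_map, List.prod_ofFn]
  rw [volume_pi, Measure.restrict_pi_pi, lintegral_eq_lmarginal_univ t, ← hprod,
    ← List.toFinset_finRange m, ← foldl_integrateAt_eq_lmarginal _ _ (List.nodup_finRange m)
      (measurable_foldl_rearrangeAt _ hF)]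
  refine foldl_integrateAt_le_foldl_normAt X _ (fun j => ENNReal.ofReal_ne_top)
    (fun j g hg => ?_) _ (antitone_foldl_rearrangeAt_finRange F) t
  obtain ⟨h0, hle⟩ := volume_real_mem_Icc (hA j)
  rcases h0.eq_or_lt with h | h
  · simp [← h]
  · exact (X j).lintegral_Ioc_le_extNorm hg h hle

/-- The exponential sum `∑ i ∈ s, c i * exp (2π √-1 k i z)` at a complex point `z`. -/
def expSum {κ : Type*} (s : Finset κ) (k : κ → ℤ) (c : κ → ℂ) (z : ℂ) : ℂ :=
  ∑ i ∈ s, c i * Complex.exp (2 * Real.pi * Complex.I * k i * z)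

/-! ### Bernstein's inequality for exponential sums -/

section expSum

variable {κ : Type*} {s : Finset κ} {k : κ → ℤ} {c : κ → ℂ} {n : ℕ} {M : ℝ}

theorem differentiable_expSum : Differentiable ℂ (expSum s k c) := by
  unfold expSum; fun_prop

theorem norm_expSum_le_of_im_nonneg (hk : ∀ i ∈ s, |k i| ≤ n)
    (hM : ∀ x : ℝ, ‖expSum s k c x‖ ≤ M) {z : ℂ} (hz : 0 ≤ z.im) :
    ‖expSum s k c z‖ ≤ M * Real.exp (2 * Real.pi * n * z.im) := by
  -- With `w = exp(2πiz)`, `Q(w) = w^n · expSum z` is a polynomial, of modulus at most `M` on the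
  -- unit circle. The maximum principle extends the bound to the disc, that is to `Im z ≥ 0`, and
  -- dividing by `|w|^n` gives the exponential factor.
  set Q : ℂ → ℂ := fun w => ∑ i ∈ s, c i * w ^ (n + k i).toNat with hQ
  have hQz : ∀ z, Q (Complex.exp (2 * Real.pi * Complex.I * z)) =
      Complex.exp (2 * Real.pi * Complex.I * z) ^ n * expSum s k c z := by
    intro z
    simp only [hQ, expSum, Finset.mul_sum]
    refine Finset.sum_congr rfl fun i hi => ?_
    have h1 : (0 : ℤ) ≤ n + k i := by linarith [neg_abs_le (k i), hk i hi]
    rw [mul_left_comm, ← Complex.exp_nat_mul, ← Complex.exp_nat_mul, ← Complex.exp_add]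
    congr 2
    have h2 : (((n + k i).toNat : ℕ) : ℂ) = n + k i := by
      have : (((n + k i).toNat : ℤ) : ℂ) = ((n + k i : ℤ) : ℂ) := by rw [Int.toNat_of_nonneg h1]
      push_cast at this
      exact this
    rw [h2]; ring
  have hnorm : ∀ z : ℂ, ‖Complex.exp (2 * Real.pi * Complex.I * z)‖ =
      Real.exp (-(2 * Real.pi * z.im)) := by
    intro z
    rw [Complex.norm_exp]
    congr 1
    simp
  have hball : ∀ w ∈ Metric.closedBall (0 : ℂ) 1, ‖Q w‖ ≤ M := by
    intro w hw
    refine Complex.norm_le_of_forall_mem_frontier_norm_le (U := Metric.ball 0 1)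
      Metric.isBounded_ball ?_ ?_ (by rwa [closure_ball _ one_ne_zero])
    · apply Differentiable.diffContOnCl
      fun_prop
    · intro w hw
      rw [frontier_ball _ one_ne_zero, mem_sphere_zero_iff_norm] at hw
      have hw' : w = Complex.exp (2 * Real.pi * Complex.I * ((w.arg / (2 * Real.pi) : ℝ) : ℂ)) := by
        conv_lhs => rw [← Complex.norm_mul_exp_arg_mul_I w, hw]
        have : (Real.pi : ℂ) ≠ 0 := by exact_mod_cast Real.pi_ne_zero
        push_cast
        rw [one_mul]
        congr 1
        field_simp
      rw [hw', hQz, norm_mul, norm_pow, hnorm, Complex.ofReal_im, mul_zero, neg_zero, Real.exp_zero,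
        one_pow, one_mul]
      exact hM _
  have h1 : ‖Q (Complex.exp (2 * Real.pi * Complex.I * z))‖ ≤ M := by
    apply hball
    rw [mem_closedBall_zero_iff, hnorm, Real.exp_le_one_iff]
    have := Real.pi_pos
    simp only [Left.neg_nonpos_iff]; positivity
  rw [hQz, norm_mul, norm_pow, hnorm, ← Real.exp_nat_mul] at h1
  have h2 : 0 < Real.exp (2 * Real.pi * n * z.im) := Real.exp_pos _
  calc ‖expSum s k c z‖ = (Real.exp (n * -(2 * Real.pi * z.im)) * ‖expSum s k c z‖) *
        Real.exp (2 * Real.pi * n * z.im) := by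
        rw [mul_right_comm, ← Real.exp_add]
        ring_nf
        simp
    _ ≤ _ := by gcongr

theorem norm_expSum_le (hk : ∀ i ∈ s, |k i| ≤ n)
    (hM : ∀ x : ℝ, ‖expSum s k c x‖ ≤ M) (z : ℂ) :
    ‖expSum s k c z‖ ≤ M * Real.exp (2 * Real.pi * n * |z.im|) := by
  rcases le_total 0 z.im with h | h
  · rw [abs_of_nonneg h]; exact norm_expSum_le_of_im_nonneg hk hM h
  · have hneg : ∀ z, expSum s (fun i => -k i) c (-z) = expSum s k c z := by
      intro z; simp [expSum]
    have := norm_expSum_le_of_im_nonneg (s := s) (k := fun i => -k i) (c := c) (n := n) (M := M)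
      (z := -z) (by simpa using hk)
      (fun x => by
        have h2 := hneg (-x)
        rw [neg_neg] at h2
        rw [h2]; exact_mod_cast hM (-x)) (by simpa using h)
    rw [hneg] at this
    rwa [abs_of_nonpos h, ← Complex.neg_im]

/-- A local form of Bernstein's inequality. -/
theorem norm_expSum_sub_le (hn : 1 ≤ n) (hk : ∀ i ∈ s, |k i| ≤ n)
    (hM : ∀ x : ℝ, ‖expSum s k c x‖ ≤ M) {u v : ℝ} (huv : |u - v| ≤ 1 / (128 * n)) :
    ‖expSum s k c u - expSum s k c v‖ ≤ M / 4 := by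
  have hn' : (0 : ℝ) < n := by exact_mod_cast hn
  have hM0 : 0 ≤ M := (norm_nonneg _).trans (hM 0)
  have hd : dist (u : ℂ) v = |u - v| := by
    rw [dist_eq_norm, ← Complex.ofReal_sub, Complex.norm_real, Real.norm_eq_abs]
  have hlt : 1 / (128 * (n : ℝ)) < 1 / (8 * n) := by
    apply one_div_lt_one_div_of_lt <;> nlinarith
  -- Schwarz lemma: on the ball of radius `1/(8n)` the sum is at most `3M`, since `2πn/(8n) ≤ 1` and
  -- `e < 3`, so it stays within `4M` of its centre value. The Lipschitz bound `32nM` times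
  -- `1/(128n)` is `M/4`.
  have h := Complex.dist_le_div_mul_dist_of_mapsTo_ball (f := expSum s k c) (c := (v : ℂ))
    (z := (u : ℂ)) (R₁ := 1 / (8 * n)) (R₂ := 4 * M) differentiable_expSum.differentiableOn ?_
    (by rw [Metric.mem_ball, hd]; linarith)
  · rw [dist_eq_norm, hd] at h
    refine h.trans ?_
    calc 4 * M / (1 / (8 * n)) * |u - v| ≤ 4 * M / (1 / (8 * n)) * (1 / (128 * n)) := by gcongr
      _ = M / 4 := by field_simp; ring
  · intro z hz
    rw [Metric.mem_ball, dist_eq_norm] at hz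
    rw [Metric.mem_closedBall, dist_eq_norm]
    have him : |z.im| ≤ 1 / (8 * n) := by
      have := Complex.abs_im_le_norm (z - v)
      simp only [Complex.sub_im, Complex.ofReal_im, sub_zero] at this
      linarith
    have hexp : Real.exp (2 * Real.pi * n * |z.im|) ≤ 3 := by
      have h1 : 2 * Real.pi * n * |z.im| ≤ 1 := by
        calc 2 * Real.pi * n * |z.im| ≤ 2 * Real.pi * n * (1 / (8 * n)) := by
              have := Real.pi_pos
              gcongr
          _ = Real.pi / 4 := by field_simp; norm_num
          _ ≤ 1 := by linarith [Real.pi_le_four]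
      exact (Real.exp_le_exp.2 h1).trans Real.exp_one_lt_three.le
    calc ‖expSum s k c z - expSum s k c v‖ ≤ ‖expSum s k c z‖ + ‖expSum s k c v‖ := norm_sub_le _ _
      _ ≤ M * 3 + M := by
          gcongr
          · exact (norm_expSum_le hk hM z).trans (by gcongr)
          · exact hM v
      _ = 4 * M := by ring

end expSum

/-! ### An interval of large `L¹` slices -/

theorem expSum_fract {κ : Type*} (s : Finset κ) (k : κ → ℤ) (c : κ → ℂ) (v : ℝ) :
    expSum s k c (Int.fract v : ℝ) = expSum s k c v := by
  unfold expSum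
  refine Finset.sum_congr rfl fun i _ => ?_
  congr 1
  rw [Complex.exp_eq_exp_iff_exists_int]
  refine ⟨-(k i * ⌊v⌋), ?_⟩
  rw [← Int.self_sub_floor]
  push_cast
  ring

/-- Duality reduces to a scalar sum: pairing with the conjugate phase `h` at a near-maximal point
`v₀` gives an exponential sum dominated by `G`, with equality at `v₀`. As `G v₀ > M/2` and the
scalar sum varies by at most `M/4` nearby, `G ≥ M/4` there. -/
theorem exists_interval_integral_norm_expSum_le {κ α : Type*} [MeasurableSpace α] (ρ : Measure α)
    {s : Finset κ} {k : κ → ℤ} {c : κ → α → ℂ} {n : ℕ} (hn : 1 ≤ n) (hk : ∀ i ∈ s, |k i| ≤ n)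
    (hc : ∀ i, Integrable (c i) ρ) :
    ∃ a : ℝ, 0 ≤ a ∧ a + 1 / (128 * n) ≤ 1 ∧ ∀ v : ℝ, ∀ u ∈ Icc a (a + 1 / (128 * n)),
      ∫ x, ‖expSum s k (fun i => c i x) v‖ ∂ρ ≤ 4 * ∫ x, ‖expSum s k (fun i => c i x) u‖ ∂ρ := by
  set G : ℝ → ℝ := fun v => ∫ x, ‖expSum s k (fun i => c i x) v‖ ∂ρ with hG
  have hn' : (1 : ℝ) ≤ n := by exact_mod_cast hn
  have hdpos : 0 < 1 / (128 * (n : ℝ)) := by positivity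
  have hdle : 1 / (128 * (n : ℝ)) ≤ 1 / 128 := by
    apply one_div_le_one_div_of_le <;> linarith
  have hint : ∀ v : ℝ, Integrable (fun x => expSum s k (fun i => c i x) v) ρ := fun v =>
    integrable_finsetSum _ fun i _ => (hc i).mul_const _
  have hG0 : ∀ v, 0 ≤ G v := fun v => integral_nonneg fun x => norm_nonneg _
  have hbdd : BddAbove (range G) := by
    refine ⟨∫ x, ∑ i ∈ s, ‖c i x‖ ∂ρ, ?_⟩
    rintro _ ⟨v, rfl⟩
    refine integral_mono (hint v).norm (integrable_finsetSum _ fun i _ => (hc i).norm) fun x => ?_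
    refine (norm_sum_le _ _).trans (Finset.sum_le_sum fun i _ => ?_)
    rw [norm_mul, Complex.norm_exp]
    simp
  set M := ⨆ v, G v
  have hGM : ∀ v, G v ≤ M := le_ciSup hbdd
  rcases ((hG0 0).trans (hGM 0)).eq_or_lt with hM | hM
  · refine ⟨0, le_rfl, by linarith, fun v u _ => ?_⟩
    have h1 := hGM v
    have h2 := hG0 u
    change G v ≤ 4 * G u
    linarith
  obtain ⟨v₁, hv₁⟩ := exists_lt_of_lt_ciSup (f := G) (show M / 2 < M by linarith)
  -- By periodicity the near-maximal point may be taken in `[0, 1)`.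
  set v₀ := Int.fract v₁
  have hv₀ : M / 2 < G v₀ := by
    simpa only [hG, v₀, expSum_fract] using hv₁
  set h : α → ℂ := fun x => (starRingEnd ℂ) (expSum s k (fun i => c i x) v₀) /
    ‖expSum s k (fun i => c i x) v₀‖
  have hhm : AEStronglyMeasurable h ρ := by
    have h1 := (hint v₀).aestronglyMeasurable.aemeasurable
    exact ((Complex.continuous_conj.measurable.comp_aemeasurable h1).div
      (Complex.measurable_ofReal.comp_aemeasurable h1.norm)).aestronglyMeasurable
  have hh1 : ∀ x, ‖h x‖ ≤ 1 := fun x => by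
    simp only [h, norm_div, RCLike.norm_conj, Complex.norm_real, norm_norm]
    exact div_self_le_one _
  have hP : ∀ v : ℝ, expSum s k (fun i => ∫ x, c i x * h x ∂ρ) v =
      ∫ x, expSum s k (fun i => c i x) v * h x ∂ρ := by
    intro v
    simp only [expSum, Finset.sum_mul]
    rw [integral_finsetSum]
    · refine Finset.sum_congr rfl fun i _ => ?_
      rw [← integral_mul_const]
      congr 1; ext x; ring
    · intro i _
      exact ((hc i).mul_const _).mul_bdd hhm (ae_of_all _ hh1)
  have hPG : ∀ v : ℝ, ‖expSum s k (fun i => ∫ x, c i x * h x ∂ρ) v‖ ≤ G v := by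
    intro v
    rw [hP]
    refine (norm_integral_le_integral_norm _).trans
      (integral_mono ((hint v).mul_bdd hhm (ae_of_all _ hh1)).norm (hint v).norm fun x => ?_)
    simp only [norm_mul]
    exact mul_le_of_le_one_right (norm_nonneg _) (hh1 x)
  have hPv₀ : ‖expSum s k (fun i => ∫ x, c i x * h x ∂ρ) v₀‖ = G v₀ := by
    have h1 : ∀ x, expSum s k (fun i => c i x) v₀ * h x =
        ((‖expSum s k (fun i => c i x) v₀‖ : ℝ) : ℂ) := by
      intro x
      simp only [h]
      rw [mul_div_assoc', Complex.mul_conj']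
      by_cases h0 : (‖expSum s k (fun i => c i x) v₀‖ : ℂ) = 0
      · simp [h0]
      · field_simp
    rw [hP]
    simp_rw [h1]
    rw [integral_complex_ofReal, Complex.norm_real, Real.norm_of_nonneg (hG0 v₀)]
  have hlower : ∀ u : ℝ, |u - v₀| ≤ 1 / (128 * n) → ∀ v, G v ≤ 4 * G u := by
    intro u hu v
    have h1 := norm_expSum_sub_le (c := fun i => ∫ x, c i x * h x ∂ρ) hn hk
      (fun x => (hPG x).trans (hGM x)) hu
    have h2 := norm_sub_norm_le (expSum s k (fun i => ∫ x, c i x * h x ∂ρ) v₀)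
      (expSum s k (fun i => ∫ x, c i x * h x ∂ρ) u)
    rw [norm_sub_rev] at h2
    have h3 := hPG u
    have h4 := hGM v
    linarith
  have hf0 : 0 ≤ v₀ := Int.fract_nonneg _
  have hf1 : v₀ < 1 := Int.fract_lt_one _
  -- The interval extends to the right or left of `v₀`, whichever stays inside `[0, 1]`.
  rcases le_total v₀ (1 / 2) with hle | hle
  · refine ⟨v₀, hf0, by linarith, fun v u hu => hlower u ?_ v⟩
    rw [abs_le]; constructor <;> linarith [hu.1, hu.2]
  · refine ⟨v₀ - 1 / (128 * n), by linarith, by linarith, fun v u hu => hlower u ?_ v⟩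
    rw [abs_le]; constructor <;> linarith [hu.1, hu.2]

/-- The trigonometric polynomial in the variable of period `1`. -/
def scaledPoly (n : Fin m → ℕ) (b : (Fin m → ℤ) → ℂ) (x : Fin m → ℝ) : ℂ :=
  trigPoly n b ((2 * Real.pi) • x)

/-! ### Replacing sides of the box by short intervals -/

theorem continuous_scaledPoly (n : Fin m → ℕ) (b : (Fin m → ℤ) → ℂ) :
    Continuous (scaledPoly n b) := by
  unfold scaledPoly trigPoly
  fun_prop

theorem norm_trigPoly_le (n : Fin m → ℕ) (b : (Fin m → ℤ) → ℂ) (x : Fin m → ℝ) :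
    ‖trigPoly n b x‖ ≤
      ∑ k ∈ Fintype.piFinset fun j => Finset.Icc (-(n j : ℤ)) (n j : ℤ), ‖b k‖ := by
  refine (norm_sum_le _ _).trans (Finset.sum_le_sum fun k _ => ?_)
  rw [norm_mul, mul_comm Complex.I, Complex.norm_exp_ofReal_mul_I, mul_one]

theorem scaledPoly_update (n : Fin m → ℕ) (b : (Fin m → ℤ) → ℂ) (x : Fin m → ℝ) (j : Fin m)
    (v : ℝ) :
    scaledPoly n b (Function.update x j v) =
      expSum (Fintype.piFinset fun j => Finset.Icc (-(n j : ℤ)) (n j : ℤ)) (fun k => k j)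
        (fun k => b k * Complex.exp (Complex.I *
          ((∑ i, (2 * Real.pi) * (Function.update x j 0 i) * (k i : ℝ) : ℝ) : ℂ))) v := by
  unfold scaledPoly trigPoly expSum
  refine Finset.sum_congr rfl fun k _ => ?_
  rw [mul_assoc, ← Complex.exp_add]
  congr 2
  have : ∑ i, ((2 * Real.pi) • Function.update x j v) i * (k i : ℝ) =
      ∑ i, (2 * Real.pi) * (Function.update x j 0 i) * (k i : ℝ) + 2 * Real.pi * v * k j := by
    rw [← Finset.add_sum_erase _ _ (Finset.mem_univ j),
      ← Finset.add_sum_erase _ (fun i => (2 * Real.pi) * (Function.update x j 0 i) * (k i : ℝ))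
        (Finset.mem_univ j)]
    have : ∀ i ∈ Finset.univ.erase j, ((2 * Real.pi) • Function.update x j v) i * (k i : ℝ) =
        (2 * Real.pi) * (Function.update x j 0 i) * (k i : ℝ) := by
      intro i hi
      simp [Finset.ne_of_mem_erase hi]
    rw [Finset.sum_congr rfl this]
    simp
    ring
  rw [this]
  push_cast
  ring

theorem isFiniteMeasure_baseMeasure {A : Fin m → Set ℝ} (hA : ∀ j, A j ⊆ Icc 0 1) (j : Fin m) :
    IsFiniteMeasure (baseMeasure A j) := by
  have : ∀ i, IsFiniteMeasure
      (Function.update (fun i => volume.restrict (A i)) j unitMeasure i) := by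
    intro i
    by_cases h : i = j
    · subst h; simp only [Function.update_self]; infer_instance
    · simp only [Function.update_of_ne h]
      exact isFiniteMeasure_restrict.2 (measure_ne_top_of_subset (hA i) (by simp))
  unfold baseMeasure
  infer_instance

theorem exists_interval_setLIntegral_scaledPoly_le {A : Fin m → Set ℝ}
    (hA : ∀ j, A j ⊆ Icc 0 1) {n : Fin m → ℕ} {j : Fin m} (hn : 1 ≤ n j)
    (b : (Fin m → ℤ) → ℂ) :
    ∃ I ⊆ Icc (0 : ℝ) 1, volume.real I = 1 / (128 * n j) ∧
      ∫⁻ x in univ.pi A, ‖scaledPoly n b x‖ₑ ≤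
        ENNReal.ofReal (512 * n j * volume.real (A j)) *
          ∫⁻ x in univ.pi (Function.update A j I), ‖scaledPoly n b x‖ₑ := by
  have := isFiniteMeasure_baseMeasure hA j
  set ρ := baseMeasure A j
  have hn' : (1 : ℝ) ≤ n j := by exact_mod_cast hn
  set c : (Fin m → ℤ) → (Fin m → ℝ) → ℂ := fun k x => b k * Complex.exp (Complex.I *
          ((∑ i, (2 * Real.pi) * (Function.update x j 0 i) * (k i : ℝ) : ℝ) : ℂ))
  have hc : ∀ k, Integrable (c k) ρ := by
    intro k
    refine Integrable.of_bound (C := ‖b k‖) ?_ (ae_of_all _ fun x => ?_)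
    · apply Continuous.aestronglyMeasurable
      fun_prop
    · rw [norm_mul, mul_comm Complex.I, Complex.norm_exp_ofReal_mul_I, mul_one]
  obtain ⟨a, ha0, ha1, ha⟩ := exists_interval_integral_norm_expSum_le ρ
    (s := Fintype.piFinset fun j => Finset.Icc (-(n j : ℤ)) (n j : ℤ)) (k := fun k => k j)
    (c := c) hn (fun k hk => abs_le.2 (Finset.mem_Icc.1 (Fintype.mem_piFinset.1 hk j))) hc
  set d : ℝ := 1 / (128 * n j) with hd
  have hd0 : 0 < d := by positivity
  refine ⟨Icc a (a + d), Icc_subset_Icc ha0 ha1, by simp [hd0.le], ?_⟩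
  have hSm : Measurable fun x => ‖scaledPoly n b x‖ₑ :=
    (continuous_scaledPoly n b).measurable.enorm
  set g : ℝ → ℝ≥0∞ := fun v => ∫⁻ x, ‖scaledPoly n b (Function.update x j v)‖ₑ ∂ρ with hg
  have hgG : ∀ v, g v = ENNReal.ofReal (∫ x, ‖expSum (Fintype.piFinset fun j =>
      Finset.Icc (-(n j : ℤ)) (n j : ℤ)) (fun k => k j) (fun k => c k x) v‖ ∂ρ) := by
    intro v
    rw [ofReal_integral_norm_eq_lintegral_enorm]
    · simp only [hg, scaledPoly_update]; rfl
    · exact integrable_finsetSum _ fun k _ => (hc k).mul_const _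
  have hgle : ∀ v, ∀ u ∈ Icc a (a + d), g v ≤ 4 * g u := by
    intro v u hu
    rw [hgG, hgG]
    refine (ENNReal.ofReal_le_ofReal (ha v u hu)).trans_eq ?_
    rw [ENNReal.ofReal_mul (by norm_num)]; simp
  have hswap : ∀ B : Set ℝ, ∫⁻ x, (∫⁻ u in B, ‖scaledPoly n b (Function.update x j u)‖ₑ) ∂ρ =
      ∫⁻ u in B, g u := fun B =>
    lintegral_lintegral_swap (hSm.comp (measurable_update_prod j)).aemeasurable
  rw [setLIntegral_pi_eq A j hSm, setLIntegral_pi_update A j _ hSm, hswap, hswap]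
  -- Averaging `g v ≤ 4 g u` over the interval of length `d = 1/(128 n j)` gives `512 = 4 · 128`.
  have hpt : ∀ v, g v ≤ ENNReal.ofReal (512 * n j) * ∫⁻ u in Icc a (a + d), g u := by
    intro v
    have h1 : g v * ENNReal.ofReal d ≤ 4 * ∫⁻ u in Icc a (a + d), g u := by
      calc g v * ENNReal.ofReal d = ∫⁻ u in Icc a (a + d), g v := by
            rw [setLIntegral_const, Real.volume_Icc, add_sub_cancel_left]
        _ ≤ ∫⁻ u in Icc a (a + d), 4 * g u :=
            setLIntegral_mono' measurableSet_Icc fun u hu => hgle v u hu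
        _ = _ := lintegral_const_mul' _ _ (by simp)
    calc g v = ENNReal.ofReal (128 * n j) * (g v * ENNReal.ofReal d) := by
          rw [mul_left_comm, ← ENNReal.ofReal_mul (by positivity), hd,
            mul_one_div_cancel (by positivity)]
          simp
      _ ≤ ENNReal.ofReal (128 * n j) * (4 * ∫⁻ u in Icc a (a + d), g u) := by gcongr
      _ = _ := by
          rw [← mul_assoc]
          congr 1
          rw [← ENNReal.ofReal_ofNat, ← ENNReal.ofReal_mul (by positivity)]
          congr 1; ring
  calc ∫⁻ u in A j, g u
      ≤ ∫⁻ _ in A j, ENNReal.ofReal (512 * n j) * ∫⁻ u in Icc a (a + d), g u :=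
        lintegral_mono fun v => hpt v
    _ = _ := by
        rw [setLIntegral_const, ENNReal.ofReal_mul (p := 512 * (n j : ℝ)) (by positivity),
          mul_right_comm]
        congr 2
        rw [ofReal_measureReal (measure_ne_top_of_subset (hA j) (by simp))]

theorem exists_setLIntegral_scaledPoly_le (e : Finset (Fin m)) {n : Fin m → ℕ}
    (hn : ∀ j ∈ e, 1 ≤ n j) {A : Fin m → Set ℝ} (hA : ∀ j, A j ⊆ Icc 0 1)
    (b : (Fin m → ℤ) → ℂ) :
    ∃ A' : Fin m → Set ℝ, (∀ j, A' j ⊆ Icc 0 1) ∧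
      (∀ j ∈ e, volume.real (A' j) = 1 / (128 * n j)) ∧ (∀ j ∉ e, A' j = A j) ∧
      ∫⁻ x in univ.pi A, ‖scaledPoly n b x‖ₑ ≤
        (∏ j ∈ e, ENNReal.ofReal (512 * n j * volume.real (A j))) *
          ∫⁻ x in univ.pi A', ‖scaledPoly n b x‖ₑ := by
  induction e using Finset.induction with
  | empty => exact ⟨A, hA, by simp, by simp, by simp⟩
  | insert j e hj ih =>
    obtain ⟨A₁, h1, h2, h3, h4⟩ := ih fun i hi => hn i (Finset.mem_insert_of_mem hi)
    obtain ⟨I, hI, hIv, hle⟩ := exists_interval_setLIntegral_scaledPoly_le h1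
      (hn j (Finset.mem_insert_self _ _)) b
    refine ⟨Function.update A₁ j I, fun i => ?_, fun i hi => ?_, fun i hi => ?_, ?_⟩
    · by_cases hij : i = j
      · subst hij; simpa using hI
      · simpa [hij] using h1 i
    · by_cases hij : i = j
      · subst hij; simpa using hIv
      · simpa [hij] using h2 i ((Finset.mem_insert.1 hi).resolve_left hij)
    · rw [Finset.mem_insert, not_or] at hi
      simpa [hi.1] using h3 i hi.2
    · rw [Finset.prod_insert hj, mul_comm (ENNReal.ofReal _), mul_assoc]
      refine h4.trans ?_
      gcongr
      rwa [h3 j hj] at hle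

/-! ### The fundamental function -/

namespace SymmetricSpace.HasFundamentalFunction

variable {X : SymmetricSpace} {φ : ℝ → ℝ}

theorem apply_eq (h : X.HasFundamentalFunction φ) {s : ℝ} (h0 : 0 ≤ s) (h1 : s ≤ 1) :
    φ s = X.norm ((Ioc 0 s).indicator fun _ => 1) := by
  rw [← h (Ioc 0 s) (Ioc_subset_Icc_self.trans (Icc_subset_Icc_right h1))
    measurableSet_Ioc.nullMeasurableSet]
  simp [h0]

theorem pos (h : X.HasFundamentalFunction φ) {s : ℝ} (h0 : 0 < s) (h1 : s ≤ 1) : 0 < φ s := by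
  rw [h.apply_eq h0.le h1]; exact X.norm_indicator_Ioc_pos h0 h1

theorem le_two_pow_mul (h : X.HasFundamentalFunction φ) (k : ℕ) {u v : ℝ} (hu : 0 < u)
    (huv : u ≤ v) (hv : v ≤ 1) (h2 : v ≤ 2 ^ k * u) : φ v ≤ 2 ^ k * φ u := by
  rw [h.apply_eq hu.le (huv.trans hv), h.apply_eq (hu.le.trans huv) hv]
  exact (X.indicator_Ioc_two_pow k hu huv hv h2 (X.indicator_one_mem measurableSet_Ioc)).2

theorem div_le_assocFun (h : X.HasFundamentalFunction φ) {t : ℝ} (h0 : 0 ≤ t)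
    (h1 : t / (2 * Real.pi) ≤ 1) :
    t / (2 * Real.pi) / φ (t / (2 * Real.pi)) ≤ 512 * assocFun φ t := by
  rcases h0.eq_or_lt with rfl | ht
  · simp [assocFun]
  have hpi := Real.pi_gt_three
  have hpi4 := Real.pi_le_four
  set u := t / (2 * Real.pi) with hu
  have hupos : 0 < u := by positivity
  have htu : t = 2 * Real.pi * u := by rw [hu]; field_simp
  have hut : u ≤ t := by rw [htu]; nlinarith
  have hmin : 0 < min t 1 := lt_min ht one_pos
  -- Three doublings suffice because `2π ≤ 8`. The generous `512` in the conclusion matches the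
  -- constant for the coordinates in `e`.
  have h2 := h.le_two_pow_mul 3 hupos (le_min hut h1) (min_le_right _ _)
    ((min_le_left _ _).trans (by rw [htu]; nlinarith))
  have hφu := h.pos hupos h1
  have hφm := h.pos hmin (min_le_right _ _)
  rw [assocFun, if_neg (not_le.2 ht), mul_div_assoc', div_le_div_iff₀ hφu hφm]
  calc u * φ (min t 1) ≤ t * (2 ^ 3 * φ u) := by gcongr
    _ ≤ 512 * t * φ u := by nlinarith [mul_pos ht hφu]

end SymmetricSpace.HasFundamentalFunction

/-! ### Finiteness, rescaling and conclusion -/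

theorem anisotropicNorm_trigPoly_lt_top (X : Fin m → SymmetricSpace) (n : Fin m → ℕ)
    (b : (Fin m → ℤ) → ℂ) : anisotropicNorm X (trigPoly n b) < ⊤ := by
  -- The summand `1` keeps the bound nonzero when all coefficients vanish.
  refine foldl_normAt_lt_top X _ (antitone_foldl_rearrangeAt_finRange _)
    (c := ENNReal.ofReal (∑ k ∈ Fintype.piFinset fun j =>
      Finset.Icc (-(n j : ℤ)) (n j : ℤ), ‖b k‖) + 1) (by finiteness) (fun t ht => ?_) 0
  refine foldl_rearrangeAt_le_of_bounded _ (by simp) (fun t _ => ?_) t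
    fun i => ht i (List.mem_finRange i)
  refine le_add_right ?_
  rw [← ofReal_norm]
  exact ENNReal.ofReal_le_ofReal (norm_trigPoly_le n b _)

open scoped Pointwise in
theorem setIntegral_pi_trigPoly (n : Fin m → ℕ) (b : (Fin m → ℤ) → ℂ) (E : Fin m → Set ℝ) :
    ∫ x in univ.pi E, ‖trigPoly n b x‖ = (2 * Real.pi) ^ m *
      ∫ x in univ.pi fun j => (fun t => 2 * Real.pi * t) ⁻¹' E j, ‖scaledPoly n b x‖ := by
  have hpi := Real.two_pi_pos
  have h := Measure.setIntegral_comp_smul (volume : Measure (Fin m → ℝ))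
    (fun x => ‖trigPoly n b x‖) (univ.pi fun j => (fun t => 2 * Real.pi * t) ⁻¹' E j) hpi.ne'
  have hs : (2 * Real.pi) • (univ.pi fun j => (fun t => 2 * Real.pi * t) ⁻¹' E j) =
      univ.pi E := by
    ext x
    rw [mem_smul_set_iff_inv_smul_mem₀ hpi.ne']
    simp only [mem_univ_pi, mem_preimage, Pi.smul_apply, smul_eq_mul,
      mul_inv_cancel_left₀ hpi.ne']
  rw [hs, Module.finrank_fin_fun, abs_of_pos (by positivity), smul_eq_mul] at h
  change ∫ x in _, ‖scaledPoly n b x‖ = _ at h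
  rw [h, mul_inv_cancel_left₀ (by positivity)]

end

theorem lemma7 (m : ℕ) (φ : Fin m → ℝ → ℝ)
    (hφ : ∀ j, 1 < lowerDilation (φ j) ∧ lowerDilation (φ j) ≤ upperDilation (φ j) ∧
      upperDilation (φ j) ≤ 2) :
    ∃ C : ℝ, 0 < C ∧
      ∀ X : Fin m → SymmetricSpace, (∀ j, (X j).HasFundamentalFunction (φ j)) →
      ∀ E : Fin m → Set ℝ, (∀ j, E j ⊆ Set.Ico 0 (2 * Real.pi)) →
        (∀ j, MeasureTheory.NullMeasurableSet (E j) MeasureTheory.volume) →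
      ∀ e : Finset (Fin m), ∀ n : Fin m → ℕ, (∀ j ∈ e, 1 ≤ n j) →
      ∀ b : (Fin m → ℤ) → ℂ,
        anisotropicNorm X (trigPoly n b) < ⊤ ∧
        ∫ x in Set.univ.pi E, ‖trigPoly n b x‖ ≤
          C * (∏ j ∈ e, 1 / φ j ((n j : ℝ)⁻¹)) * (∏ j ∈ e, MeasureTheory.volume.real (E j)) *
            (∏ j ∈ eᶜ, assocFun (φ j) (MeasureTheory.volume.real (E j))) *
            (anisotropicNorm X (trigPoly n b)).toReal := by
  have hpi := Real.two_pi_pos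
  refine ⟨(2 * Real.pi) ^ m * 512 ^ m, by positivity, fun X hX E hE _ e n hn b =>
    ⟨anisotropicNorm_trigPoly_lt_top X n b, ?_⟩⟩
  set N := anisotropicNorm X (trigPoly n b) with hN
  have hNfin : N ≠ ⊤ := (anisotropicNorm_trigPoly_lt_top X n b).ne
  set A : Fin m → Set ℝ := fun j => (fun t => 2 * Real.pi * t) ⁻¹' E j with hA_def
  have hA : ∀ j, A j ⊆ Icc 0 1 := by
    intro j t ht
    obtain ⟨h1, h2⟩ := hE j ht
    exact ⟨by simpa [hpi] using h1, by nlinarith⟩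
  have hvol : ∀ j, volume.real (A j) = volume.real (E j) / (2 * Real.pi) := by
    intro j
    rw [measureReal_def, hA_def, Real.volume_preimage_mul_left hpi.ne', abs_of_pos (by positivity),
      ENNReal.toReal_mul, ENNReal.toReal_ofReal (by positivity), ← measureReal_def, inv_mul_eq_div]
  set B : Fin m → ℝ := fun j => if j ∈ e then 1 / φ j ((n j : ℝ)⁻¹) * volume.real (E j)
    else assocFun (φ j) (volume.real (E j)) with hB
  have hBprod : (∏ j ∈ e, 1 / φ j ((n j : ℝ)⁻¹)) * (∏ j ∈ e, volume.real (E j)) *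
      (∏ j ∈ eᶜ, assocFun (φ j) (volume.real (E j))) = ∏ j, B j := by
    rw [← Finset.prod_mul_prod_compl e B, ← Finset.prod_mul_distrib]
    congr 1
    · exact Finset.prod_congr rfl fun j hj => by simp [hB, hj]
    · exact Finset.prod_congr rfl fun j hj => by simp [hB, Finset.mem_compl.1 hj]
  obtain ⟨A', hA', hA'e, hA'c, hle⟩ := exists_setLIntegral_scaledPoly_le e hn hA b
  have hle2 : ∫⁻ x in univ.pi A', ‖scaledPoly n b x‖ₑ ≤ (∏ j, ENNReal.ofReal (volume.real (A' j) /
        (X j).norm ((Ioc 0 (volume.real (A' j))).indicator fun _ => 1))) * N :=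
    setLIntegral_pi_le_foldl_normAt X hA' (continuous_scaledPoly n b).measurable.enorm 0
  -- `D j` is the total cost of coordinate `j`: the passage to a short interval (only for `j ∈ e`)
  -- times the Marcinkiewicz factor.
  set D : Fin m → ℝ := fun j => (if j ∈ e then 512 * n j * volume.real (A j) else 1) *
    (volume.real (A' j) / φ j (volume.real (A' j))) with hD
  have hφnn : ∀ j, 0 ≤ φ j (volume.real (A' j)) := fun j => by
    obtain ⟨h0, h1⟩ := volume_real_mem_Icc (hA' j)
    rw [(hX j).apply_eq h0 h1]
    exact (X j).norm_nonneg _ ((X j).indicator_one_mem measurableSet_Ioc)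
  have hD0 : ∀ j, 0 ≤ D j := by
    intro j
    have := hφnn j
    simp only [hD]
    split_ifs <;> positivity
  have hle3 : ∫⁻ x in univ.pi A, ‖scaledPoly n b x‖ₑ ≤ ENNReal.ofReal (∏ j, D j) * N := by
    refine hle.trans ((mul_le_mul_right hle2 _).trans_eq ?_)
    rw [← mul_assoc, ENNReal.ofReal_prod_of_nonneg fun j _ => hD0 j]
    congr 1
    have h1 : ∏ j ∈ e, ENNReal.ofReal (512 * n j * volume.real (A j)) =
        ∏ j, ENNReal.ofReal (if j ∈ e then 512 * n j * volume.real (A j) else 1) := by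
      rw [← Finset.prod_mul_prod_compl e, Finset.prod_congr rfl (g := fun _ => 1) (s₁ := eᶜ)
        (fun j hj => by simp [Finset.mem_compl.1 hj])]
      simp only [Finset.prod_const_one, mul_one]
      exact Finset.prod_congr rfl fun j hj => by simp [hj]
    rw [h1, ← Finset.prod_mul_distrib]
    refine Finset.prod_congr rfl fun j _ => ?_
    obtain ⟨h0, h1⟩ := volume_real_mem_Icc (hA' j)
    rw [← (hX j).apply_eq h0 h1, ← ENNReal.ofReal_mul]
    split_ifs <;> positivity
  have hDB : ∀ j, D j ≤ 512 * B j := by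
    intro j
    have hE0 : 0 ≤ volume.real (E j) := measureReal_nonneg
    by_cases hj : j ∈ e
    · have hnj : (1 : ℝ) ≤ n j := by exact_mod_cast hn j hj
      have hnpos : (0 : ℝ) < n j := by linarith
      have hu0 : (0 : ℝ) < 1 / (128 * n j) := by positivity
      have hle1 : ((n j : ℝ))⁻¹ ≤ 1 := inv_le_one_of_one_le₀ hnj
      have huv : 1 / (128 * (n j : ℝ)) ≤ (n j : ℝ)⁻¹ := by
        rw [← one_div]
        apply one_div_le_one_div_of_le <;> linarith
      -- Seven doublings lead from `1/(128 n)` to `1/n`; with the factor `4 = 512/128` this costs `4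
      -- · 128 = 512`.
      have h2 := (hX j).le_two_pow_mul 7 hu0 huv hle1 (by field_simp; norm_num)
      have hp1 := (hX j).pos hu0 (huv.trans hle1)
      have hp2 := (hX j).pos (inv_pos.2 hnpos) hle1
      simp only [hD, hB, hj, if_true, hA'e j hj, hvol]
      set p := φ j (1 / (128 * n j))
      set q := φ j ((n j : ℝ)⁻¹)
      have hw : volume.real (E j) / (2 * Real.pi) ≤ volume.real (E j) :=
        div_le_self hE0 (by linarith [Real.pi_gt_three])
      have hpq : 1 / p ≤ 128 * (1 / q) := by
        rw [mul_one_div, div_le_div_iff₀ hp1 hp2]; linarith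
      calc 512 * (n j : ℝ) * (volume.real (E j) / (2 * Real.pi)) * (1 / (128 * n j) / p)
          = 4 * (volume.real (E j) / (2 * Real.pi)) * (1 / p) := by field_simp; ring
        _ ≤ 4 * volume.real (E j) * (128 * (1 / q)) := by gcongr
        _ = 512 * (1 / q * volume.real (E j)) := by ring
    · simp only [hD, hB, hj, if_false, hA'c j hj, hvol, one_mul]
      refine (hX j).div_le_assocFun hE0 ?_
      rw [← hvol]
      exact (volume_real_mem_Icc (hA j)).2
  have hfinal : ∫ x in univ.pi A, ‖scaledPoly n b x‖ ≤ (512 ^ m * ∏ j, B j) * N.toReal := by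
    rw [integral_norm_eq_lintegral_enorm (continuous_scaledPoly n b).aestronglyMeasurable]
    refine (ENNReal.toReal_mono (by finiteness) hle3).trans ?_
    rw [ENNReal.toReal_mul, ENNReal.toReal_ofReal (Finset.prod_nonneg fun j _ => hD0 j)]
    gcongr
    refine (Finset.prod_le_prod (fun j _ => hD0 j) fun j _ => hDB j).trans_eq ?_
    simp [Finset.prod_mul_distrib]
  rw [setIntegral_pi_trigPoly]
  calc (2 * Real.pi) ^ m * ∫ x in univ.pi A, ‖scaledPoly n b x‖
      ≤ (2 * Real.pi) ^ m * ((512 ^ m * ∏ j, B j) * N.toReal) := by gcongr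
    _ = _ := by rw [← hBprod]; ring
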